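/- **Setting.** Let $(\Omega,\mathcal F,\mathsf P)$ be a probability space, $L^0$ the space of (classes of) real random variables, and $\mathcal P$ the set of probability measures absolutely continuous with respect to $\mathsf P$. For $\mathsf Q\in\mathcal P$ and $X\in L^0$ put $\mathsf E_{\mathsf Q}X=\mathsf E_{\mathsf Q}X^+-\mathsf E_{\mathsf Q}X^-\in[-\infty,\infty]$ with the convention $\infty-\infty=-\infty$. A coherent utility function is a map $u:L^0\to[-\infty,\infty]$ of the form $u(X)=\inf_{\mathsf Q\in\mathcal D_0}\mathsf E_{\mathsf Q}X$ with $\emptyset\ne\mathcal D_0\subseteq\mathcal P$; its determining set is the largest such set, $\{\mathsf Q\in\mathcal P:\mathsf E_{\mathsf Q}X\ge u(X)\ \forall X\in L^0\}$. A set $\mathcal D\subseteq\mathcal P$ is weakly compact if the set of densities $\{d\mathsf Q/d\mathsf P:\mathsf Q\in\mathcal D\}$ is compact in the weak topology of $L^1(\mathsf P)$. Let $L^1_s(\mathcal D)$ be the set of $X\in L^0$ with $\lim_{k\to\infty}\sup_{\mathsf Q\in\mathcal D}\mathsf E_{\mathsf Q}\bigl[|X|\,1_{\{|X|>k\}}\bigr]=0$.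 For $A\subseteq L^0$ let $\mathcal R(A)=\{\mathsf Q\in\mathcal P:\mathsf E_{\mathsf Q}X\le0\ \forall X\in A\}$; $A$ is called $\mathcal D$-consistent if there is $A'\subseteq A\cap L^1_s(\mathcal D)$ with $\mathcal D\cap\mathcal R(A)=\mathcal D\cap\mathcal R(A')$. Let $u_1,\dots,u_N$ be coherent utility functions with weakly compact determining sets $\mathcal D_1,\dots,\mathcal D_N$, let $A_n\subseteq L^0$ be a $\mathcal D_n$-consistent convex cone containing $0$, let $W_n\in L^1_s(\mathcal D_n)$, and let $S=(S^1,\dots,S^d)$ be a random vector with components in $\bigcap_nL^1_s(\mathcal D_n)$. Put $$G_n=\operatorname{cl}\{\mathsf E_{\mathsf Q}S:\mathsf Q\in\mathcal D_n\cap\mathcal R(A_n)\}\subseteq\mathbb R^d,\qquad \widetilde G_n=\operatorname{cl}\{\mathsf E_{\mathsf Q}(S,W_n):\mathsf Q\in\mathcal D_n\cap\mathcal R(A_n)\}\subseteq\mathbb R^{d+1},$$ $$f_n(x)=\inf\{y:(x,y)\in\widetilde G_n\}\ (x\in G_n),\qquad G=\bigcap_{n=1}^NG_n,\qquad f(x)=\sum_{n=1}^Nf_n(x)\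 (x\in G),$$ and, for $P\in G_n$, $$N_{\widetilde G_n}(P)=\Bigl\{\eta\in\mathbb R^d:\langle(\eta,1),(P,f_n(P))\rangle=\inf_{z\in\widetilde G_n}\langle(\eta,1),z\rangle\Bigr\}.$$ An Arrow–Debreu-type equilibrium is a collection $(X_1,\dots,X_N,h_1,\dots,h_N,P)$ with $X_n\in A_n$, $h_n\in\mathbb R^d$, $\sum_nh_n=0$, $P\in\mathbb R^d$ such that for every $n$ $$u_n(W_n+X_n+\langle h_n,S-P\rangle)=\max_{\xi\in A_n,\ \eta\in\mathbb R^d}u_n(W_n+\xi+\langle\eta,S-P\rangle).$$ **Theorem.** Assume that the relative interiors of $G_1,\dots,G_N$ have a common point. 1. Let $P\in\operatorname{argmin}_{x\in G}f(x)$. Then there exist $h_n\in N_{\widetilde G_n}(P)$, $n=1,\dots,N$, with $\sum_nh_n=0$. Moreover, for any such $h_1,\dots,h_N$ and any $X_n\in\operatorname{argmax}_{\xi\in A_n}u_n(W_n+\xi+\langle h_n,S\rangle)$, $n=1,\dots,N$, the collection $(X_1,\dots,X_N,h_1,\dots,h_N,P)$ is an Arrow–Debreu-type equilibrium. 2. Conversely,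 if $(X_1,\dots,X_N,h_1,\dots,h_N,P)$ is an Arrow–Debreu-type equilibrium, then $P\in\operatorname{argmin}_{x\in G}f(x)$, $h_n\in N_{\widetilde G_n}(P)$ for every $n$, $\sum_nh_n=0$, and $X_n\in\operatorname{argmax}_{\xi\in A_n}u_n(W_n+\xi+\langle h_n,S\rangle)$ for every $n$. -/

import Mathlib

open MeasureTheory Filter Topology
open scoped ENNReal NNReal

namespace CoherentEquilibrium

noncomputable section

variable {Ω : Type*} [MeasurableSpace Ω] {μ : Measure Ω}

/-! ### Coherent utility functions on the space `L⁰ = Ω →ₘ[μ] ℝ` -/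

/-- The set of probability measures that are absolutely continuous with respect to `μ`. -/
def acProb (μ : Measure Ω) : Set (Measure Ω) :=
  {Q | IsProbabilityMeasure Q ∧ Q ≪ μ}

/-- The extended expectation `E_Q X = E_Q X⁺ - E_Q X⁻` with the convention `∞ - ∞ = -∞`
(this is the convention of `EReal`, where `⊤ - ⊤ = ⊥`). -/
def expect (Q : Measure Ω) (X : Ω →ₘ[μ] ℝ) : EReal :=
  ((∫⁻ ω, ENNReal.ofReal (X ω) ∂Q : ℝ≥0∞) : EReal)
    - ((∫⁻ ω, ENNReal.ofReal (-(X ω)) ∂Q : ℝ≥0∞) : EReal)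

/-- A coherent utility function on `L⁰`: `u X = inf_{Q ∈ D} E_Q X` for some nonempty set `D`
of probability measures absolutely continuous with respect to `μ`. -/
def IsCoherentUtility (u : (Ω →ₘ[μ] ℝ) → EReal) : Prop :=
  ∃ D : Set (Measure Ω), D ⊆ acProb μ ∧ D.Nonempty ∧ ∀ X, u X = ⨅ Q ∈ D, expect Q X

/-- The determining set of `u`: the largest set of measures that represents `u`. -/
def determiningSet (u : (Ω →ₘ[μ] ℝ) → EReal) : Set (Measure Ω) :=
  {Q | Q ∈ acProb μ ∧ ∀ X, u X ≤ expect Q X}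

/-- The set of densities `dQ/dμ`, `Q ∈ D`, as a subset of `L¹(μ)`. -/
def densities (μ : Measure Ω) (D : Set (Measure Ω)) : Set (Lp ℝ 1 μ) :=
  {Z | ∃ Q ∈ D, ∀ᵐ ω ∂μ, Z ω = (Q.rnDeriv μ ω).toReal}

/-- Weak compactness of a set of absolutely continuous measures: the set of densities is compact
in the weak topology of `L¹(μ)`. -/
def IsWeaklyCompact (μ : Measure Ω) (D : Set (Measure Ω)) : Prop :=
  IsCompact (toWeakSpace ℝ (Lp ℝ 1 μ) '' densities μ D)

/-- The strong space `L¹_s(D)`: those `X` with `sup_{Q ∈ D} E_Q [|X|; |X| > k] → 0`. -/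
def L1s (μ : Measure Ω) (D : Set (Measure Ω)) : Set (Ω →ₘ[μ] ℝ) :=
  {X | Tendsto (fun k : ℕ => ⨆ Q ∈ D, ∫⁻ ω in {ω | (k : ℝ) < |X ω|}, ENNReal.ofReal |X ω| ∂Q)
    atTop (𝓝 0)}

/-- The set of risk-neutral measures of `A`. -/
def riskNeutral (A : Set (Ω →ₘ[μ] ℝ)) : Set (Measure Ω) :=
  {Q | Q ∈ acProb μ ∧ ∀ X ∈ A, expect Q X ≤ 0}

/-- `A` is `D`-consistent: there is `A' ⊆ A ∩ L¹_s(D)` with `D ∩ R(A) = D ∩ R(A')`. -/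
def IsConsistent (D : Set (Measure Ω)) (A : Set (Ω →ₘ[μ] ℝ)) : Prop :=
  ∃ A' : Set (Ω →ₘ[μ] ℝ), A' ⊆ A ∩ L1s μ D ∧ D ∩ riskNeutral A = D ∩ riskNeutral A'

/-! ### The contracts and the generating sets -/

variable {d : ℕ}

/-- The payoff `⟨h, S⟩` of the portfolio `h` of the contracts `S`. -/
def payoff (h : EuclideanSpace ℝ (Fin d)) (S : Fin d → (Ω →ₘ[μ] ℝ)) : Ω →ₘ[μ] ℝ :=
  ∑ i, h i • S i

/-- The random vector `S - P` for a deterministic price vector `P`. -/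
def excess (S : Fin d → (Ω →ₘ[μ] ℝ)) (P : EuclideanSpace ℝ (Fin d)) : Fin d → (Ω →ₘ[μ] ℝ) :=
  fun i => S i - AEEqFun.const Ω (P i)

/-- The vector `E_Q S` (used only when the components of `S` are `Q`-integrable). -/
def meanVec (Q : Measure Ω) (S : Fin d → (Ω →ₘ[μ] ℝ)) : EuclideanSpace ℝ (Fin d) :=
  WithLp.toLp 2 fun i => ∫ ω, S i ω ∂Q

/-- `G_n = cl {E_Q S : Q ∈ D_n ∩ R(A_n)}`. -/
def genSet (D : Set (Measure Ω)) (A : Set (Ω →ₘ[μ] ℝ)) (S : Fin d → (Ω →ₘ[μ] ℝ)) :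
    Set (EuclideanSpace ℝ (Fin d)) :=
  closure {x | ∃ Q ∈ D ∩ riskNeutral A, x = meanVec Q S}

/-- `G̃_n = cl {E_Q (S, W_n) : Q ∈ D_n ∩ R(A_n)}`, a subset of `ℝᵈ × ℝ`. -/
def genSetExt (D : Set (Measure Ω)) (A : Set (Ω →ₘ[μ] ℝ)) (S : Fin d → (Ω →ₘ[μ] ℝ))
    (W : Ω →ₘ[μ] ℝ) : Set (EuclideanSpace ℝ (Fin d) × ℝ) :=
  closure {z | ∃ Q ∈ D ∩ riskNeutral A, z = (meanVec Q S, ∫ ω, W ω ∂Q)}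

/-- The lower boundary `x ↦ inf {y : (x, y) ∈ K}` of a subset `K` of `ℝᵈ × ℝ`. -/
def lowerBdry (K : Set (EuclideanSpace ℝ (Fin d) × ℝ)) (x : EuclideanSpace ℝ (Fin d)) : ℝ :=
  sInf {y | (x, y) ∈ K}

/-- The set of `η ∈ ℝᵈ` with `⟨(η, 1), (P, f(P))⟩ = inf_{z ∈ K} ⟨(η, 1), z⟩`,
where `f` is the lower boundary of `K`. -/
def normalSet (K : Set (EuclideanSpace ℝ (Fin d) × ℝ)) (P : EuclideanSpace ℝ (Fin d)) :
    Set (EuclideanSpace ℝ (Fin d)) :=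
  {η | IsGLB ((fun z : EuclideanSpace ℝ (Fin d) × ℝ => inner ℝ η z.1 + z.2) '' K)
    (inner ℝ η P + lowerBdry K P)}

/-! ### Optimality and equilibrium -/

/-- The set of minimizers of `f` over `G`. -/
def argminOn {E : Type*} (f : E → ℝ) (G : Set E) : Set E :=
  {x | x ∈ G ∧ ∀ y ∈ G, f x ≤ f y}

/-- The set of maximizers of the extended-valued function `v` over `A`. -/
def argmaxOn {E : Type*} (v : E → EReal) (A : Set E) : Set E :=
  {x | x ∈ A ∧ ∀ y ∈ A, v y ≤ v x}

/-- Arrow-Debreu-type equilibrium `(X, h, P)` of agents with utility functions `u n`, attainable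
sets `A n` and endowments `W n` who exchange the contracts `S`. -/
structure IsArrowDebreu {N : ℕ} (u : Fin N → (Ω →ₘ[μ] ℝ) → EReal)
    (A : Fin N → Set (Ω →ₘ[μ] ℝ)) (W : Fin N → (Ω →ₘ[μ] ℝ)) (S : Fin d → (Ω →ₘ[μ] ℝ))
    (X : Fin N → (Ω →ₘ[μ] ℝ)) (h : Fin N → EuclideanSpace ℝ (Fin d))
    (P : EuclideanSpace ℝ (Fin d)) : Prop where
  mem : ∀ n, X n ∈ A n
  sum_eq_zero : ∑ n, h n = 0
  optimal : ∀ n, ∀ ξ ∈ A n, ∀ η : EuclideanSpace ℝ (Fin d),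
    u n (W n + ξ + payoff η (excess S P)) ≤ u n (W n + X n + payoff (h n) (excess S P))

end

end CoherentEquilibrium

open CoherentEquilibrium

/-! Duality turns each agent's problem into finite-dimensional convex geometry. If `Q` is in the
determining set and risk-neutral, attainable payoffs have nonpositive `Q`-expectation, so `u (W + ξ
+ ⟨η, S⟩)` is at most `⟨η, x⟩ + y` at every `(x, y)` of `G̃` (`utility_le_of_mem_genSetExt`).
Conversely, separation over the weakly compact determining set shows that the supremum over `ξ`
reaches the minimum of `⟨(η, 1), ·⟩` on `G̃` (`exists_le_utility_of_lt`); consistency supplies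
constraints that are weakly continuous.

By cash invariance, trading at price `P` subtracts `⟨η, P⟩`. The agent thus maximizes over `η` the
minimum of `⟨η, x - P⟩ + y` on `G̃`; for `P ∈ G_n` the optimal value is `f_n(P)` if a maximizer
exists, and the maximizers are the support vectors in `normalSet`. A finite optimum also forces `P ∈
G_n`, by separation (`exists_mem_le_of_forall_exists`).

Market clearing links the agents. Adding support inequalities with `∑ h n = 0` cancels the linear
terms and leaves the minimality of `f` at `P`. Conversely, minimality yields support vectors that
sum to zero: this is the subdifferential sum rule `exists_multipliers`, with the common relative
interior point as qualification. -/

namespace CoherentEquilibrium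

/-! ### Convex separation and multipliers -/

section Convex

/-- If every affine functional of slope `(η, 1)` takes a value at most `c` relative to `P` on the
compact convex set `K`, then `K` meets the half-line below `(P, c)`. -/
theorem exists_mem_le_of_forall_exists {E : Type*} [NormedAddCommGroup E] [InnerProductSpace ℝ E]
    [CompleteSpace E] {K : Set (E × ℝ)} (hK : IsCompact K) (hKc : Convex ℝ K) {P : E} {c : ℝ}
    (h : ∀ η : E, ∃ z ∈ K, inner ℝ η z.1 + z.2 ≤ inner ℝ η P + c) :
    ∃ y ≤ c, (P, y) ∈ K := by
  by_contra! hno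
  obtain ⟨f, u, v, hu, huv, hv⟩ := geometric_hahn_banach_compact_closed hKc hK
    (t := {z : E × ℝ | z.1 = P ∧ z.2 ≤ c})
    (by
      rintro ⟨x, y⟩ ⟨rfl, hy⟩ ⟨x', y'⟩ ⟨h1, hy'⟩ a b ha hb hab
      dsimp only at *
      subst h1
      refine ⟨by simp [← add_smul, hab], ?_⟩
      simp only [Prod.smul_mk, Prod.mk_add_mk, smul_eq_mul]
      calc a * y + b * y' ≤ a * c + b * c := by gcongr
        _ = c := by rw [← add_mul, hab, one_mul])
    ((isClosed_eq continuous_fst continuous_const).inter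
      (isClosed_le continuous_snd continuous_const))
    (by
      rw [Set.disjoint_left]
      rintro ⟨x, y⟩ hz ⟨rfl, hy⟩
      exact hno y hy hz)
  set η := (InnerProductSpace.toDual ℝ E).symm (f.comp (ContinuousLinearMap.inl ℝ E ℝ)) with hη
  set a := f (0, 1) with ha
  have hf : ∀ x y, f (x, y) = inner ℝ η x + y * a := by
    intro x y
    have h1 : inner ℝ η x = f (x, 0) := by
      rw [hη, InnerProductSpace.toDual_symm_apply]; rfl
    have h2 : y * a = f (0, y) := by
      rw [ha, ← smul_eq_mul, ← map_smul]; simp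
    rw [h1, h2, ← map_add]; simp
  have hu' : ∀ z ∈ K, inner ℝ η z.1 + z.2 * a < u := fun z hz => by
    rw [← hf]; exact hu z hz
  have hv' : ∀ y ≤ c, v < inner ℝ η P + y * a := fun y hy => by
    rw [← hf]; exact hv (P, y) ⟨rfl, hy⟩
  -- The half-line is unbounded below, which excludes a positive vertical coefficient.
  have ha0 : a ≤ 0 := by
    by_contra! hpos
    have h1 := hv' (min c ((v - inner ℝ η P) / a)) (min_le_left _ _)
    have h2 : min c ((v - inner ℝ η P) / a) * a ≤ v - inner ℝ η P := by
      rw [← le_div_iff₀ hpos]; exact min_le_right _ _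
    linarith
  rcases ha0.lt_or_eq with hneg | hzero
  · obtain ⟨z, hz, hle⟩ := h (a⁻¹ • η)
    have h1 := hu' z hz
    have h2 := hv' c le_rfl
    rw [real_inner_smul_left, real_inner_smul_left] at hle
    have h3 := mul_le_mul_of_nonpos_left hle hneg.le
    have h4 : ∀ r s : ℝ, a * (a⁻¹ * r + s) = r + s * a := fun r s => by
      rw [mul_add, mul_inv_cancel_left₀ hneg.ne, mul_comm s]
    rw [h4, h4] at h3
    linarith
  -- Vertical hyperplane: a steep tilt along `-η` makes the gap `v - u` outweigh the bounded second
  -- coordinate. The factor `s + 1` is chosen so that the gain `(s + 1) * (v - u)` exceeds `|c -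
  -- m|`.
  · obtain ⟨m, hm⟩ := (hK.image continuous_snd).bddBelow
    set s := |c - m| / (v - u) with hs
    have h2 := hv' c le_rfl
    simp only [hzero, mul_zero, add_zero] at h2
    have hs0 : 0 ≤ s := div_nonneg (abs_nonneg _) (by linarith)
    have h5 : s * (v - u) = |c - m| := by
      rw [hs]; field_simp [(sub_pos.2 huv).ne']
    obtain ⟨z, hz, hle⟩ := h (-(s + 1) • η)
    have h1 := hu' z hz
    have h3 : m ≤ z.2 := hm ⟨z, hz, rfl⟩
    simp only [hzero, mul_zero, add_zero] at h1
    rw [real_inner_smul_left, real_inner_smul_left] at hle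
    have h6 : (s + 1) * (v - u) ≤ (s + 1) * (inner ℝ η P - inner ℝ η z.1) := by
      gcongr
    have := le_abs_self (c - m)
    nlinarith

/-- Existence of a subgradient at a point of the algebraic relative interior. -/
theorem exists_linearMap_nonneg {F : Type*} [AddCommGroup F] [Module ℝ F] {K : Set (F × ℝ)}
    (hK : Convex ℝ K) (hne : K.Nonempty)
    (hri : ∀ z ∈ K, ∃ ε > (0 : ℝ), ∃ t, (-(ε • z.1), t) ∈ K)
    (h0 : ∀ t, ((0 : F), t) ∈ K → 0 ≤ t) :
    ∃ l : F →ₗ[ℝ] ℝ, ∀ z ∈ K, 0 ≤ l z.1 + z.2 := by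
  obtain ⟨z₀, hz₀⟩ := hne
  -- The cone generated by `K`; `l` will come from a functional nonnegative on it.
  let s : PointedCone ℝ (F × ℝ) :=
    { carrier := {w | ∃ r : ℝ, 0 ≤ r ∧ ∃ z ∈ K, w = r • z}
      zero_mem' := ⟨0, le_rfl, z₀, hz₀, by simp⟩
      add_mem' := by
        rintro _ _ ⟨r, hr, z, hz, rfl⟩ ⟨r', hr', z', hz', rfl⟩
        rcases (add_nonneg hr hr').eq_or_lt with h | h
        · refine ⟨0, le_rfl, z, hz, ?_⟩
          have h1 : r = 0 := by linarith
          have h2 : r' = 0 := by linarith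
          simp [h1, h2]
        · refine ⟨r + r', h.le, (r / (r + r')) • z + (r' / (r + r')) • z',
            hK hz hz' (by positivity) (by positivity) (by field_simp), ?_⟩
          rw [smul_add, smul_smul, smul_smul, mul_div_cancel₀ _ h.ne', mul_div_cancel₀ _ h.ne']
      smul_mem' := by
        rintro ⟨c, hc⟩ _ ⟨r, hr, z, hz, rfl⟩
        exact ⟨c * r, mul_nonneg hc hr, z, hz, (mul_smul c r z).symm⟩ }
  have hs : ∀ w, w ∈ s ↔ ∃ r : ℝ, 0 ≤ r ∧ ∃ z ∈ K, w = r • z := fun w => Iff.rfl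
  let L : Submodule ℝ F := Submodule.span ℝ (Prod.fst '' K)
  -- The cone projects onto the whole span: a negative multiple of a point is reached through the
  -- opposite point given by `hri`.
  have hL : ∀ w ∈ L, ∃ t, (w, t) ∈ s := by
    have hsmul : ∀ (a : ℝ), 0 ≤ a → ∀ w t, (w, t) ∈ s → (a • w, a * t) ∈ s := fun a ha w t h =>
      s.smul_mem ha h
    intro w hw
    induction hw using Submodule.span_induction with
    | mem x hx =>
      obtain ⟨z, hz, rfl⟩ := hx
      exact ⟨z.2, 1, zero_le_one, z, hz, by simp⟩
    | zero => exact ⟨0, s.zero_mem⟩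
    | add x y _ _ hx hy =>
      obtain ⟨t, ht⟩ := hx
      obtain ⟨t', ht'⟩ := hy
      exact ⟨t + t', s.add_mem ht ht'⟩
    | smul a x _ hx =>
      obtain ⟨t, ht⟩ := hx
      rcases le_total 0 a with ha | ha
      · exact ⟨_, hsmul a ha _ _ ht⟩
      · obtain ⟨r, hr, z, hz, hxz⟩ := (hs _).1 ht
        obtain ⟨ε, hε, t', ht'⟩ := hri z hz
        refine ⟨(-a * r / ε) * t', -a * r / ε, ?_, _, ht', ?_⟩
        · have : 0 ≤ -a := by linarith
          positivity
        · have hx : x = r • z.1 := congrArg Prod.fst hxz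
          ext
          · simp only [hx, Prod.smul_fst, smul_smul, ← neg_smul]
            congr 1
            field_simp
          · simp
  -- Riesz extension of `(m, t) ↦ t` from `M × ℝ`. A cone point over `M` lies over `L ∩ M = 0`, so
  -- `h0` gives positivity there, and `hL` gives the required cofinality.
  obtain ⟨M, hM⟩ := L.exists_isCompl
  obtain ⟨g, hg, hgs⟩ := riesz_extension s
    ⟨M.prod ⊤, (LinearMap.snd ℝ F ℝ).comp (M.prod ⊤).subtype⟩
    (by
      rintro ⟨⟨m, t⟩, hm, _⟩ hmt
      obtain ⟨r, hr, z, hz, hxz⟩ := (hs (m, t)).1 hmt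
      have hm1 : m = r • z.1 := congrArg Prod.fst hxz
      have ht1 : t = r * z.2 := congrArg Prod.snd hxz
      have hmL : m ∈ L := by
        rw [hm1]; exact L.smul_mem _ (Submodule.subset_span ⟨z, hz, rfl⟩)
      have hm0 : m = 0 := Submodule.disjoint_def.1 hM.disjoint m hmL hm
      change 0 ≤ t
      rw [ht1]
      rcases hr.eq_or_lt with h | h
      · simp [← h]
      · refine mul_nonneg hr (h0 _ ?_)
        have : z.1 = 0 := by
          rw [hm0] at hm1
          exact (smul_eq_zero.1 hm1.symm).resolve_left h.ne'
        rw [← this]; exact hz)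
    (by
      rintro ⟨w, t⟩
      have hw : w ∈ L ⊔ M := by rw [hM.sup_eq_top]; trivial
      obtain ⟨l, hl, m, hm, rfl⟩ := Submodule.mem_sup.1 hw
      obtain ⟨t', ht'⟩ := hL l hl
      refine ⟨⟨(-m, t' - t), M.neg_mem hm, trivial⟩, ?_⟩
      change (-m + (l + m), t' - t + t) ∈ s
      simpa using ht')
  refine ⟨g.comp (LinearMap.inl ℝ F ℝ), fun z hz => ?_⟩
  have h1 : g (0, z.2) = z.2 := hg ⟨(0, z.2), M.zero_mem, trivial⟩
  have h2 : 0 ≤ g z := hgs z ⟨1, zero_le_one, z, hz, by simp⟩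
  have h3 : z = (z.1, 0) + (0, z.2) := by simp
  rw [h3, map_add, h1] at h2
  exact h2

/-- Multipliers for the minimization of a sum of convex functions whose domains have a common
relative interior point. -/
theorem exists_multipliers {ι E : Type*} [Fintype ι] [DecidableEq ι] [AddCommGroup E] [Module ℝ E]
    {K : ι → Set (E × ℝ)} (hK : ∀ n, Convex ℝ (K n)) {x₀ : E}
    (hx₀ : ∀ n, ∀ z ∈ K n, ∀ᶠ ε in 𝓝[>] (0 : ℝ), ∃ t, (x₀ + ε • (x₀ - z.1), t) ∈ K n)
    {P : E} {c : ι → ℝ} (hP : ∀ n, (P, c n) ∈ K n)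
    (hmin : ∀ (x : E) (y : ι → ℝ), (∀ n, (x, y n) ∈ K n) → ∑ n, c n ≤ ∑ n, y n) :
    ∃ l : ι → E →ₗ[ℝ] ℝ, ∑ n, l n = 0 ∧ ∀ n, ∀ z ∈ K n, l n P + c n ≤ l n z.1 + z.2 := by
  -- Perturbation set: deviations of the individual points from a common `x`, with the resulting
  -- excess cost. Minimality says that zero deviation has nonnegative excess.
  let V : Set ((ι → E) × ℝ) := {w | ∃ (x : E) (z : ι → E × ℝ), (∀ n, z n ∈ K n) ∧
    w = (fun n => (z n).1 - x, ∑ n, (z n).2 - ∑ n, c n)}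
  have hPV : ∀ x : E, ((fun _ => P - x, 0) : (ι → E) × ℝ) ∈ V := fun x =>
    ⟨x, fun n => (P, c n), hP, by simp⟩
  obtain ⟨l, hl⟩ := exists_linearMap_nonneg (K := V)
    (by
      rintro _ ⟨x, z, hz, rfl⟩ _ ⟨x', z', hz', rfl⟩ a b ha hb hab
      refine ⟨a • x + b • x', fun n => a • z n + b • z' n, fun n => hK n (hz n) (hz' n) ha hb hab,
        ?_⟩
      ext n
      · simp only [Prod.smul_mk, Prod.mk_add_mk, Pi.add_apply, Pi.smul_apply, Prod.fst_add,
          Prod.smul_fst]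
        module
      · simp only [Prod.smul_mk, Prod.mk_add_mk, Prod.snd_add, Prod.smul_snd, smul_eq_mul,
          Finset.sum_add_distrib, ← Finset.mul_sum]
        linear_combination (-∑ n, c n) * hab)
    ⟨_, hPV 0⟩
    (by
      rintro _ ⟨x, z, hz, rfl⟩
      -- Reflecting `x` and every `z n` through `x₀` with one common `ε` negates the deviations.
      obtain ⟨ε, hε, hε0⟩ := ((eventually_all.2 fun n => hx₀ n (z n) (hz n)).and
        self_mem_nhdsWithin).exists
      choose t ht using hε
      refine ⟨ε, hε0, ∑ n, t n - ∑ n, c n, x₀ + ε • (x₀ - x), fun n => (x₀ + ε • (x₀ - (z n).1), t n), ht, ?_⟩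
      ext n
      · simp only [Pi.neg_apply, Pi.smul_apply]
        module
      · rfl)
    (by
      rintro t ⟨x, z, hz, h⟩
      have h1 : ∀ n, (z n).1 = x := fun n =>
        (sub_eq_zero.1 (congrFun (congrArg Prod.fst h) n).symm)
      have h2 : t = _ := congrArg Prod.snd h
      rw [h2, sub_nonneg]
      exact hmin x (fun n => (z n).2) fun n => by rw [← h1 n]; exact hz n)
  have hlsum : ∀ w : ι → E, l w = ∑ n, l (Pi.single n (w n)) := fun w => by
    rw [← map_sum, Finset.univ_sum_single]
  refine ⟨fun n => l.comp (LinearMap.single ℝ (fun _ => E) n), ?_, fun n z hz => ?_⟩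
  -- A common shift costs nothing, so the sum of the multipliers is nonnegative at `x` and at `-x`,
  -- hence zero.
  · have key : ∀ x : E, 0 ≤ (∑ n, l.comp (LinearMap.single ℝ (fun _ => E) n)) x := fun x => by
      have h1 := hl _ (hPV (P - x))
      rw [hlsum] at h1
      simpa [LinearMap.sum_apply] using h1
    ext x
    refine le_antisymm ?_ (key x)
    have := key (-x)
    rw [map_neg] at this
    simpa using this
  · have h1 := hl _ ⟨P, Function.update (fun n => (P, c n)) n z, fun m => by
      rcases eq_or_ne m n with rfl | hm
      · simpa using hz
      · simpa [hm] using hP m, rfl⟩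
    have h2 : (fun m => (Function.update (fun n => (P, c n)) n z m).1 - P)
        = Pi.single n (z.1 - P) := by
      ext m
      rcases eq_or_ne m n with rfl | hm <;> simp [*]
    have h3 : ∑ m, (Function.update (fun n => (P, c n)) n z m).2 - ∑ m, c m = z.2 - c n := by
      rw [← Finset.sum_sub_distrib, Finset.sum_eq_single n]
      · simp
      · intro m _ hm
        simp [hm]
      · simp
    dsimp only at h1
    rw [h2, h3, Pi.single_sub, map_sub] at h1
    simp only [LinearMap.comp_apply, LinearMap.single_apply]
    linarith

/-- The line from `y` through `x` stays in the affine span, where `s` is a neighbourhood of `x`, so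
the segment can be prolonged past `x`. -/
theorem eventually_add_smul_sub_mem {E : Type*} [NormedAddCommGroup E] [NormedSpace ℝ E]
    {s : Set E} {x y : E} (hx : x ∈ intrinsicInterior ℝ s) (hy : y ∈ s) :
    ∀ᶠ ε in 𝓝[>] (0 : ℝ), x + ε • (x - y) ∈ s := by
  obtain ⟨x', hx', rfl⟩ := mem_intrinsicInterior.1 hx
  have hmem : ∀ ε : ℝ, (x' : E) + ε • ((x' : E) - y) ∈ affineSpan ℝ s := fun ε => by
    have := AffineMap.lineMap_mem (-ε) x'.2 (subset_affineSpan ℝ s hy)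
    convert this using 1
    rw [AffineMap.lineMap_apply, vsub_eq_sub, vadd_eq_add]
    module
  have hc : Continuous fun ε : ℝ => (⟨(x' : E) + ε • ((x' : E) - y), hmem ε⟩ : affineSpan ℝ s) := by
    fun_prop
  have h1 : Tendsto (fun ε : ℝ => (⟨(x' : E) + ε • ((x' : E) - y), hmem ε⟩ : affineSpan ℝ s))
      (𝓝 0) (𝓝 x') := by
    have := hc.tendsto 0
    simpa using this
  have h2 := h1.eventually (mem_interior_iff_mem_nhds.1 hx')
  exact (h2.filter_mono nhdsWithin_le_nhds).mono fun ε h => h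

/-- Lagrange duality over a compact space for finitely many of a family of constraints. -/
theorem exists_finset_sum_gt {T ι : Type*} [TopologicalSpace T] [CompactSpace T]
    {φ : ι → T → ℝ} (hφ : ∀ i, Continuous (φ i)) {ψ : T → ℝ} (hψ : Continuous ψ)
    (hconv : ∀ s t : T, ∀ a b : ℝ, 0 ≤ a → 0 ≤ b → a + b = 1 →
      ∃ r, (∀ i, φ i r = a * φ i s + b * φ i t) ∧ ψ r = a * ψ s + b * ψ t)
    {m : ℝ} (hm : ∀ t, (∀ i, φ i t ≤ 0) → m < ψ t) (hne : ∃ t, ∀ i, φ i t ≤ 0) :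
    ∃ (s : Finset ι) (b : s → ℝ), (∀ i, 0 ≤ b i) ∧ ∀ t, m < ψ t + ∑ i, b i * φ i t := by
  classical
  -- Compactness of `{ψ ≤ m}` leaves finitely many constraints that already exclude it.
  obtain ⟨s, hs⟩ := (isClosed_le hψ continuous_const : IsClosed {t | ψ t ≤ m}).isCompact
    |>.elim_finite_subfamily_closed (fun i => {t | φ i t ≤ 0})
      (fun i => isClosed_le (hφ i) continuous_const)
      (by
        ext t
        simp only [Set.mem_inter_iff, Set.mem_ofPred_eq, Set.mem_iInter, Set.mem_empty_iff_false,
          iff_false, not_and]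
        exact fun h1 h2 => (hm t h2).not_ge h1)
  let Φ : T → (s → ℝ) × ℝ := fun t => (fun i => φ i t, ψ t)
  have hΦ : Continuous Φ := (continuous_pi fun i : s => hφ i.1).prodMk hψ
  obtain ⟨f, u, v, hu, huv, hv⟩ := geometric_hahn_banach_compact_closed (s := Set.range Φ)
    (t := {w : (s → ℝ) × ℝ | w.1 ≤ 0 ∧ w.2 ≤ m})
    (by
      rintro _ ⟨t, rfl⟩ _ ⟨t', rfl⟩ a b ha hb hab
      obtain ⟨r, hr, hr'⟩ := hconv t t' a b ha hb hab
      refine ⟨r, ?_⟩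
      ext i
      · simp [Φ, hr]
      · simp [Φ, hr'])
    (isCompact_range hΦ)
    ((convex_Iic (𝕜 := ℝ) (0 : s → ℝ)).prod (convex_Iic (𝕜 := ℝ) m))
    ((isClosed_Iic (a := (0 : s → ℝ))).prod (isClosed_Iic (a := m)))
    (by
      rw [Set.disjoint_left]
      rintro _ ⟨t, rfl⟩ ⟨h1, h2⟩
      have : t ∈ ({t | ψ t ≤ m} ∩ ⋂ i ∈ s, {t | φ i t ≤ 0}) := by
        refine ⟨h2, ?_⟩
        simp only [Set.mem_iInter]
        exact fun i hi => h1 ⟨i, hi⟩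
      rw [hs] at this
      exact this)
  set β : s → ℝ := fun i => f (Pi.single i 1, 0) with hβ
  set a := f (0, 1) with ha
  have hf : ∀ x y, f (x, y) = ∑ i, x i * β i + y * a := by
    intro x y
    have h1 : (x, y) = ∑ i, x i • ((Pi.single i 1, 0) : (s → ℝ) × ℝ) + y • ((0, 1) : (s → ℝ) × ℝ) := by
      ext i
      · simp [Prod.fst_sum, Finset.sum_apply, Pi.single_apply]
      · simp [Prod.snd_sum]
    rw [h1, map_add, map_sum]
    simp only [map_smul, smul_eq_mul, hβ, ha]
  have hneg : ∀ (p q : ℝ), (∀ r ≥ (0 : ℝ), v < p + -r * q) → q ≤ 0 := by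
    intro p q h
    by_contra! hq
    have h1 := h (|v - p| / q + 1) (by positivity)
    have h2 : (|v - p| / q + 1) * q = |v - p| + q := by field_simp
    have := neg_abs_le (v - p)
    nlinarith
  have hβ0 : ∀ i, β i ≤ 0 := fun i => by
    refine hneg (m * a) _ fun r hr => ?_
    have := hv (Pi.single i (-r), m) ⟨by
      intro j
      rcases eq_or_ne j i with rfl | hj <;> simp [*], le_rfl⟩
    rw [hf] at this
    simpa [Pi.single_apply, add_comm] using this
  have ha0 : a ≤ 0 := by
    refine hneg (m * a) _ fun r hr => ?_
    have := hv (0, m - r) ⟨le_rfl, by simpa using hr⟩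
    rw [hf] at this
    simp only [Pi.zero_apply, zero_mul, Finset.sum_const_zero, zero_add] at this
    linarith
  have hvm : v < m * a := by
    have := hv (0, m) ⟨le_rfl, le_rfl⟩
    rw [hf] at this
    simpa using this
  have hK : ∀ t, ∑ i : s, φ i t * β i + ψ t * a < u := fun t => by
    rw [← hf (fun i => φ i t) (ψ t)]; exact hu _ ⟨t, rfl⟩
  rcases ha0.lt_or_eq with hlt | heq
  · refine ⟨s, fun i => β i / a, fun i => div_nonneg_of_nonpos (hβ0 i) ha0, fun t => ?_⟩
    have h1 := hK t
    have h2 : ∑ i : s, β i / a * φ i t = (∑ i : s, φ i t * β i) / a := by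
      rw [Finset.sum_div]
      exact Finset.sum_congr rfl fun i _ => by ring
    have h3 : ψ t * a + ∑ i : s, φ i t * β i < m * a := by linarith
    rw [h2]
    have h4 : ψ t + (∑ i : s, φ i t * β i) / a = (ψ t * a + ∑ i : s, φ i t * β i) / a := by
      rw [add_div, mul_div_cancel_right₀ _ hlt.ne]
    rw [h4, lt_div_iff_of_neg hlt]
    exact h3
  -- No Slater condition is needed: separation is strict, so `a = 0` would make the weighted sum
  -- negative at a feasible point, where every term is nonnegative.
  · obtain ⟨t, ht⟩ := hne
    have h1 := hK t
    have h2 : 0 ≤ ∑ i : s, φ i t * β i :=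
      Finset.sum_nonneg fun i _ => mul_nonneg_of_nonpos_of_nonpos (ht i) (hβ0 i)
    rw [heq] at h1 hvm
    linarith

end Convex

/-! ### Extended expectations and cash invariance -/

section Expectation

variable {Ω : Type*} [MeasurableSpace Ω] {μ Q Q' : Measure Ω}

theorem expect_eq_integral {X : Ω →ₘ[μ] ℝ} (h : Integrable X Q) :
    expect Q X = ((∫ ω, X ω ∂Q : ℝ) : EReal) := by
  have h1 : ∫⁻ ω, ENNReal.ofReal (X ω) ∂Q ≠ ∞ :=
    (Integrable.lintegral_lt_top h).ne
  have h2 : ∫⁻ ω, ENNReal.ofReal (-(X ω)) ∂Q ≠ ∞ :=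
    (Integrable.lintegral_lt_top h.neg).ne
  rw [integral_eq_lintegral_pos_part_sub_lintegral_neg_part h]
  unfold expect
  lift ∫⁻ ω, ENNReal.ofReal (X ω) ∂Q to ℝ≥0 using h1 with p
  lift ∫⁻ ω, ENNReal.ofReal (-(X ω)) ∂Q to ℝ≥0 using h2 with q
  rfl

theorem ofReal_add_identity (x v : ℝ) :
    ENNReal.ofReal (x + v) + ENNReal.ofReal (-x) + ENNReal.ofReal (-v)
      = ENNReal.ofReal (-(x + v)) + ENNReal.ofReal x + ENNReal.ofReal v := by
  simp only [ENNReal.ofReal, ← ENNReal.coe_add, ENNReal.coe_inj]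
  apply NNReal.coe_injective
  simp only [NNReal.coe_add, Real.coe_toNNReal']
  have h : ∀ t : ℝ, max t 0 = max (-t) 0 + t := fun t => by
    rcases le_total 0 t with h | h
    · rw [max_eq_left h, max_eq_right (by linarith)]; ring
    · rw [max_eq_right h, max_eq_left (by linarith)]; ring
  rw [h (x + v), h x, h v]
  ring

/-- Only `V` is integrable. The positive and negative parts are compared without subtraction; an
infinite negative part of `X` survives in `X + V`, so the convention `⊤ - ⊤ = ⊥` is respected. -/
theorem expect_add {X V : Ω →ₘ[μ] ℝ} (hQ : Q ≪ μ) (hV : Integrable V Q) :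
    expect Q (X + V) = expect Q X + ((∫ ω, V ω ∂Q : ℝ) : EReal) := by
  have hXm : Measurable X := X.stronglyMeasurable.measurable
  have hVm : Measurable V := V.stronglyMeasurable.measurable
  have hae : ∀ᵐ ω ∂Q, (X + V) ω = X ω + V ω := hQ.ae_le (AEEqFun.coeFn_add X V)
  have ha : ∫⁻ ω, ENNReal.ofReal ((X + V) ω) ∂Q = ∫⁻ ω, ENNReal.ofReal (X ω + V ω) ∂Q :=
    lintegral_congr_ae (hae.mono fun ω h => by simp only [h])
  have hb : ∫⁻ ω, ENNReal.ofReal (-(X + V) ω) ∂Q = ∫⁻ ω, ENNReal.ofReal (-(X ω + V ω)) ∂Q :=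
    lintegral_congr_ae (hae.mono fun ω h => by simp only [h])
  have key : ∫⁻ ω, ENNReal.ofReal (X ω + V ω) ∂Q + ∫⁻ ω, ENNReal.ofReal (-X ω) ∂Q
      + ∫⁻ ω, ENNReal.ofReal (-V ω) ∂Q = ∫⁻ ω, ENNReal.ofReal (-(X ω + V ω)) ∂Q
      + ∫⁻ ω, ENNReal.ofReal (X ω) ∂Q + ∫⁻ ω, ENNReal.ofReal (V ω) ∂Q := by
    rw [← lintegral_add_left (by fun_prop), ← lintegral_add_left (by fun_prop),
      ← lintegral_add_left (by fun_prop), ← lintegral_add_left (by fun_prop)]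
    exact lintegral_congr fun ω => ofReal_add_identity _ _
  have hle1 : ∫⁻ ω, ENNReal.ofReal (X ω + V ω) ∂Q
      ≤ ∫⁻ ω, ENNReal.ofReal (X ω) ∂Q + ∫⁻ ω, ENNReal.ofReal (V ω) ∂Q := by
    rw [← lintegral_add_left (by fun_prop)]
    exact lintegral_mono fun ω => ENNReal.ofReal_add_le
  have hle2 : ∫⁻ ω, ENNReal.ofReal (-(X ω + V ω)) ∂Q
      ≤ ∫⁻ ω, ENNReal.ofReal (-X ω) ∂Q + ∫⁻ ω, ENNReal.ofReal (-V ω) ∂Q := by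
    rw [← lintegral_add_left (by fun_prop)]
    refine lintegral_mono fun ω => ?_
    rw [neg_add]
    exact ENNReal.ofReal_add_le
  have hle3 : ∫⁻ ω, ENNReal.ofReal (-X ω) ∂Q
      ≤ ∫⁻ ω, ENNReal.ofReal (-(X ω + V ω)) ∂Q + ∫⁻ ω, ENNReal.ofReal (V ω) ∂Q := by
    rw [← lintegral_add_left (by fun_prop)]
    refine lintegral_mono fun ω => ?_
    have : -X ω = -(X ω + V ω) + V ω := by ring
    rw [this]
    exact ENNReal.ofReal_add_le
  rw [integral_eq_lintegral_pos_part_sub_lintegral_neg_part hV]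
  unfold expect
  rw [ha, hb]
  have hr : ∫⁻ ω, ENNReal.ofReal (V ω) ∂Q ≠ ∞ := (Integrable.lintegral_lt_top hV).ne
  have hs : ∫⁻ ω, ENNReal.ofReal (-V ω) ∂Q ≠ ∞ := (Integrable.lintegral_lt_top hV.neg).ne
  generalize ∫⁻ ω, ENNReal.ofReal (X ω + V ω) ∂Q = a at *
  generalize ∫⁻ ω, ENNReal.ofReal (-(X ω + V ω)) ∂Q = b at *
  generalize ∫⁻ ω, ENNReal.ofReal (X ω) ∂Q = p at *
  generalize ∫⁻ ω, ENNReal.ofReal (-X ω) ∂Q = q at *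
  generalize ∫⁻ ω, ENNReal.ofReal (V ω) ∂Q = r at *
  generalize ∫⁻ ω, ENNReal.ofReal (-V ω) ∂Q = s at *
  lift r to ℝ≥0 using hr
  lift s to ℝ≥0 using hs
  induction q with
  | top =>
    obtain rfl : b = ∞ := by simpa using hle3
    simp
  | coe q =>
    lift b to ℝ≥0 using ne_top_of_le_ne_top (by finiteness) hle2
    induction p with
    | top =>
      have : a = ∞ := by
        by_contra h
        lift a to ℝ≥0 using h
        simp only [top_add, add_top] at key
        exact ENNReal.coe_ne_top (r := a + q + s) (by push_cast; exact key)
      subst this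
      rfl
    | coe p =>
      lift a to ℝ≥0 using ne_top_of_le_ne_top (by finiteness) hle1
      have h : (a : ℝ) + q + s = b + p + r := by exact_mod_cast key
      have h2 : (a : ℝ) - b = p - q + (r - s) := by linarith
      exact congrArg Real.toEReal h2

/-- A subtraction-free form, stable under mixing of measures. -/
theorem coe_le_expect_iff {X : Ω →ₘ[μ] ℝ} {c : ℝ} :
    (c : EReal) ≤ expect Q X ↔ ∫⁻ ω, ENNReal.ofReal (-X ω) ∂Q ≠ ∞ ∧
      ENNReal.ofReal c + ∫⁻ ω, ENNReal.ofReal (-X ω) ∂Q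
        ≤ ∫⁻ ω, ENNReal.ofReal (X ω) ∂Q + ENNReal.ofReal (-c) := by
  unfold expect
  generalize ∫⁻ ω, ENNReal.ofReal (X ω) ∂Q = p
  generalize ∫⁻ ω, ENNReal.ofReal (-X ω) ∂Q = q
  induction q with
  | top => simp
  | coe q =>
    induction p with
    | top => simp
    | coe p =>
      have h : ((p : ℝ≥0∞) : EReal) - ((q : ℝ≥0∞) : EReal) = (((p : ℝ) - q : ℝ) : EReal) := rfl
      rw [h, EReal.coe_le_coe_iff]
      simp only [ENNReal.ofReal, ← ENNReal.coe_add, ENNReal.coe_le_coe, ne_eq, ENNReal.coe_ne_top,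
        not_false_eq_true, true_and]
      rw [← NNReal.coe_le_coe]
      simp only [NNReal.coe_add, Real.coe_toNNReal']
      rcases le_total 0 c with h | h
      · rw [max_eq_left h, max_eq_right (by linarith)]
        constructor <;> intro <;> linarith
      · rw [max_eq_right h, max_eq_left (by linarith)]
        constructor <;> intro <;> linarith

theorem lintegral_mix (a b : ℝ≥0∞) (g : Ω → ℝ≥0∞) :
    ∫⁻ ω, g ω ∂(a • Q + b • Q') = a * ∫⁻ ω, g ω ∂Q + b * ∫⁻ ω, g ω ∂Q' := by
  rw [lintegral_add_measure, lintegral_smul_measure, lintegral_smul_measure]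
  rfl

theorem le_expect_mix {X : Ω →ₘ[μ] ℝ} {c : EReal} {a b : ℝ≥0∞} (hab : a + b = 1)
    (h : c ≤ expect Q X) (h' : c ≤ expect Q' X) : c ≤ expect (a • Q + b • Q') X := by
  have ha : a ≠ ∞ := ne_top_of_le_ne_top ENNReal.one_ne_top (hab ▸ le_self_add)
  have hb : b ≠ ∞ := ne_top_of_le_ne_top ENNReal.one_ne_top (hab ▸ le_add_self)
  refine EReal.ge_of_forall_gt_iff_ge.1 fun z hz => ?_
  obtain ⟨h1, h2⟩ := coe_le_expect_iff.1 (hz.le.trans h)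
  obtain ⟨h1', h2'⟩ := coe_le_expect_iff.1 (hz.le.trans h')
  rw [coe_le_expect_iff, lintegral_mix, lintegral_mix]
  refine ⟨by finiteness, ?_⟩
  have e : ∀ t : ℝ≥0∞, t = a * t + b * t := fun t => by rw [← add_mul, hab, one_mul]
  calc _ = a * (ENNReal.ofReal z + ∫⁻ ω, ENNReal.ofReal (-X ω) ∂Q)
        + b * (ENNReal.ofReal z + ∫⁻ ω, ENNReal.ofReal (-X ω) ∂Q') := by
        nth_rw 1 [e (ENNReal.ofReal z)]; ring
    _ ≤ a * (∫⁻ ω, ENNReal.ofReal (X ω) ∂Q + ENNReal.ofReal (-z))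
        + b * (∫⁻ ω, ENNReal.ofReal (X ω) ∂Q' + ENNReal.ofReal (-z)) := by gcongr
    _ = _ := by nth_rw 3 [e (ENNReal.ofReal (-z))]; ring

theorem expect_nonpos_iff {X : Ω →ₘ[μ] ℝ} :
    expect Q X ≤ 0 ↔ ∫⁻ ω, ENNReal.ofReal (X ω) ∂Q ≤ ∫⁻ ω, ENNReal.ofReal (-X ω) ∂Q := by
  unfold expect
  rw [EReal.sub_nonpos, EReal.coe_ennreal_le_coe_ennreal_iff]

theorem expect_mix_nonpos {X : Ω →ₘ[μ] ℝ} {a b : ℝ≥0∞}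
    (h : expect Q X ≤ 0) (h' : expect Q' X ≤ 0) : expect (a • Q + b • Q') X ≤ 0 := by
  rw [expect_nonpos_iff] at *
  rw [lintegral_mix, lintegral_mix]
  gcongr

theorem mix_mem_acProb (hQ : Q ∈ acProb μ) (hQ' : Q' ∈ acProb μ) {a b : ℝ≥0∞} (hab : a + b = 1) :
    a • Q + b • Q' ∈ acProb μ := by
  have := hQ.1
  have := hQ'.1
  refine ⟨⟨by simp [hab]⟩, ?_⟩
  exact (Measure.AbsolutelyContinuous.add_left ((Measure.smul_absolutelyContinuous).trans hQ.2)
    ((Measure.smul_absolutelyContinuous).trans hQ'.2))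

theorem mix_mem_determiningSet {u : (Ω →ₘ[μ] ℝ) → EReal} (hQ : Q ∈ determiningSet u)
    (hQ' : Q' ∈ determiningSet u) {a b : ℝ≥0∞} (hab : a + b = 1) :
    a • Q + b • Q' ∈ determiningSet u :=
  ⟨mix_mem_acProb hQ.1 hQ'.1 hab, fun X => le_expect_mix hab (hQ.2 X) (hQ'.2 X)⟩

theorem mix_mem_riskNeutral {A : Set (Ω →ₘ[μ] ℝ)} (hQ : Q ∈ riskNeutral A)
    (hQ' : Q' ∈ riskNeutral A) {a b : ℝ≥0∞} (hab : a + b = 1) :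
    a • Q + b • Q' ∈ riskNeutral A :=
  ⟨mix_mem_acProb hQ.1 hQ'.1 hab, fun X hX => expect_mix_nonpos (hQ.2 X hX) (hQ'.2 X hX)⟩

theorem integral_mix {g : Ω → ℝ} (hg : Integrable g Q) (hg' : Integrable g Q') {a b : ℝ}
    (ha : 0 ≤ a) (hb : 0 ≤ b) :
    ∫ ω, g ω ∂(ENNReal.ofReal a • Q + ENNReal.ofReal b • Q') = a * ∫ ω, g ω ∂Q + b * ∫ ω, g ω ∂Q' := by
  rw [integral_add_measure (hg.smul_measure ENNReal.ofReal_ne_top)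
    (hg'.smul_measure ENNReal.ofReal_ne_top), integral_smul_measure, integral_smul_measure,
    ENNReal.toReal_ofReal ha, ENNReal.toReal_ofReal hb, smul_eq_mul, smul_eq_mul]

/-- Any representing set is contained in the determining set. -/
theorem le_utility {u : (Ω →ₘ[μ] ℝ) → EReal} (hu : IsCoherentUtility u) {X : Ω →ₘ[μ] ℝ}
    {c : EReal} (h : ∀ Q ∈ determiningSet u, c ≤ expect Q X) : c ≤ u X := by
  obtain ⟨D, hD, -, hu⟩ := hu
  rw [hu X]
  exact le_iInf₂ fun Q hQ => h Q ⟨hD hQ, fun Y => by rw [hu Y]; exact iInf₂_le Q hQ⟩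

theorem utility_add_const_le {u : (Ω →ₘ[μ] ℝ) → EReal} (hu : IsCoherentUtility u)
    (X : Ω →ₘ[μ] ℝ) (c : ℝ) : u X + c ≤ u (X + AEEqFun.const Ω c) := by
  refine le_utility hu fun Q hQ => ?_
  have := hQ.1.1
  have hc : (AEEqFun.const Ω c : Ω →ₘ[μ] ℝ) =ᵐ[Q] fun _ => c :=
    hQ.1.2.ae_le (AEEqFun.coeFn_const Ω c)
  rw [expect_add hQ.1.2 ((integrable_const c).congr hc.symm), integral_congr_ae hc]
  simp only [integral_const, probReal_univ, one_smul]
  gcongr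
  exact hQ.2 X

theorem const_add_const (a b : ℝ) :
    (AEEqFun.const Ω a : Ω →ₘ[μ] ℝ) + AEEqFun.const Ω b = AEEqFun.const Ω (a + b) := rfl

theorem utility_add_const {u : (Ω →ₘ[μ] ℝ) → EReal} (hu : IsCoherentUtility u)
    (X : Ω →ₘ[μ] ℝ) (c : ℝ) : u (X + AEEqFun.const Ω c) = u X + c := by
  refine le_antisymm ?_ (utility_add_const_le hu X c)
  have h1 := utility_add_const_le hu (X + AEEqFun.const Ω c) (-c)
  have h0 : X + AEEqFun.const Ω (0 : ℝ) = X := add_zero X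
  rw [add_assoc, const_add_const, add_neg_cancel, h0, EReal.coe_neg] at h1
  exact EReal.sub_le_iff_le_add (by simp) (by simp) |>.1 h1

theorem payoff_excess {d : ℕ} (h P : EuclideanSpace ℝ (Fin d)) (S : Fin d → (Ω →ₘ[μ] ℝ)) :
    payoff h (excess S P) = payoff h S + AEEqFun.const Ω (-inner ℝ h P) := by
  have h1 : ∀ (s : Finset (Fin d)) (g : Fin d → ℝ),
      (AEEqFun.const Ω (∑ i ∈ s, g i) : Ω →ₘ[μ] ℝ) = ∑ i ∈ s, AEEqFun.const Ω (g i) := by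
    classical
    intro s g
    induction s using Finset.induction_on with
    | empty => simp; rfl
    | insert i s hi ih => rw [Finset.sum_insert hi, Finset.sum_insert hi, ← ih]; rfl
  have h2 : ∀ c x : ℝ, c • (AEEqFun.const Ω x : Ω →ₘ[μ] ℝ) = AEEqFun.const Ω (c * x) :=
    fun c x => rfl
  have h3 : ∀ c : ℝ, (AEEqFun.const Ω (-c) : Ω →ₘ[μ] ℝ) = -AEEqFun.const Ω c := fun c => rfl
  simp only [payoff, excess, smul_sub, Finset.sum_sub_distrib, h2, h3, PiLp.inner_apply, h1,
    ← sub_eq_add_neg]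
  simp [mul_comm]

end Expectation

/-! ### Weak continuity and superhedging duality -/

section WeakTopology

variable {Ω : Type*} [MeasurableSpace Ω] {μ : Measure Ω} {D : Set (Measure Ω)}

open Classical in
/-- The density `dQ/dμ` as an element of `L¹(μ)`. -/
noncomputable def density (μ Q : Measure Ω) : Lp ℝ 1 μ :=
  if h : Integrable (fun ω => (Q.rnDeriv μ ω).toReal) μ then h.toL1 _ else 0

theorem density_ae {Q : Measure Ω} (hQ : Q ∈ acProb μ) :
    ∀ᵐ ω ∂μ, density μ Q ω = (Q.rnDeriv μ ω).toReal := by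
  have := hQ.1
  have h : Integrable (fun ω => (Q.rnDeriv μ ω).toReal) μ := Measure.integrable_toReal_rnDeriv
  rw [density, dif_pos h]
  exact h.coeFn_toL1

/-- The topology on `D` induced by the weak topology of `L¹(μ)` on densities. -/
@[reducible]
noncomputable def weakTop (μ : Measure Ω) (D : Set (Measure Ω)) : TopologicalSpace D :=
  TopologicalSpace.induced (fun Q : D => toWeakSpace ℝ (Lp ℝ 1 μ) (density μ Q)) inferInstance

theorem compactSpace_weakTop (hD : D ⊆ acProb μ) (hDc : IsWeaklyCompact μ D) :
    @CompactSpace D (weakTop μ D) := by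
  let _ := weakTop μ D
  have hind : IsInducing (fun Q : D => toWeakSpace ℝ (Lp ℝ 1 μ) (density μ Q)) := ⟨rfl⟩
  refine ⟨hind.isCompact_iff.2 ?_⟩
  suffices h : (fun Q : D => toWeakSpace ℝ (Lp ℝ 1 μ) (density μ Q)) '' Set.univ
      = toWeakSpace ℝ (Lp ℝ 1 μ) '' densities μ D by
    rw [h]; exact hDc
  ext z
  constructor
  · rintro ⟨Q, -, rfl⟩
    exact ⟨_, ⟨Q, Q.2, density_ae (hD Q.2)⟩, rfl⟩
  · rintro ⟨Z, ⟨Q, hQ, hZ⟩, rfl⟩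
    refine ⟨⟨Q, hQ⟩, trivial, ?_⟩
    dsimp only
    congr 1
    refine Lp.ext ?_
    filter_upwards [hZ, density_ae (hD hQ)] with ω h1 h2
    rw [h1, h2]

/-- A bounded `g` pairs with densities as a continuous functional on `L¹(μ)`. -/
theorem continuous_integral_of_bounded [SigmaFinite μ] (hD : D ⊆ acProb μ) {g : Ω → ℝ}
    (hg : Measurable g) {C : ℝ} (hC : ∀ ω, |g ω| ≤ C) :
    Continuous[weakTop μ D, _] fun Q : D => ∫ ω, g ω ∂(Q : Measure Ω) := by
  let _ := weakTop μ D
  have hint : ∀ z : Lp ℝ 1 μ, Integrable (fun ω => z ω * g ω) μ := fun z =>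
    (L1.integrable_coeFn z).mul_bdd hg.aestronglyMeasurable (ae_of_all _ hC)
  let l : Lp ℝ 1 μ →ₗ[ℝ] ℝ :=
    { toFun := fun z => ∫ ω, z ω * g ω ∂μ
      map_add' := fun z z' => by
        rw [← integral_add (hint z) (hint z')]
        refine integral_congr_ae ?_
        filter_upwards [Lp.coeFn_add z z'] with ω h
        rw [h, Pi.add_apply, add_mul]
      map_smul' := fun c z => by
        rw [← integral_smul]
        refine integral_congr_ae ?_
        filter_upwards [Lp.coeFn_smul c z] with ω h
        rw [h, Pi.smul_apply, smul_eq_mul, mul_assoc]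
        rfl }
  let L : StrongDual ℝ (Lp ℝ 1 μ) := l.mkContinuous C fun z => by
    rw [L1.norm_eq_integral_norm, ← integral_const_mul]
    refine (norm_integral_le_integral_norm _).trans (integral_mono (hint z).norm
      ((L1.integrable_coeFn z).norm.const_mul C) fun ω => ?_)
    rw [norm_mul, mul_comm]
    exact mul_le_mul_of_nonneg_right (hC ω) (norm_nonneg _)
  have h1 : Continuous fun z : WeakSpace ℝ (Lp ℝ 1 μ) => L ((toWeakSpace ℝ (Lp ℝ 1 μ)).symm z) :=
    WeakBilin.eval_continuous (topDualPairing ℝ (Lp ℝ 1 μ)).flip L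
  have h2 : (fun Q : D => ∫ ω, g ω ∂(Q : Measure Ω)) = (fun z => L ((toWeakSpace ℝ _).symm z)) ∘
      fun Q : D => toWeakSpace ℝ (Lp ℝ 1 μ) (density μ Q) := by
    ext Q
    have := (hD Q.2).1
    rw [← integral_rnDeriv_smul (hD Q.2).2]
    change _ = ∫ ω, density μ Q ω * g ω ∂μ
    refine integral_congr_ae ?_
    filter_upwards [density_ae (hD Q.2)] with ω h
    rw [h, smul_eq_mul]
  rw [h2]
  exact h1.comp continuous_induced_dom

/-- `X` is integrable with respect to every element of `D`, and the expectation depends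
continuously on the measure for the weak topology. -/
structure IsWeaklyContinuous (μ : Measure Ω) (D : Set (Measure Ω)) (X : Ω →ₘ[μ] ℝ) : Prop where
  integrable : ∀ Q ∈ D, Integrable X Q
  continuous : Continuous[weakTop μ D, _] fun Q : D => ∫ ω, X ω ∂(Q : Measure Ω)

/-- Expectations of truncations are weakly continuous, and the tail condition makes them converge
uniformly over `D`. -/
theorem isWeaklyContinuous_of_mem_L1s [SigmaFinite μ] (hD : D ⊆ acProb μ) {X : Ω →ₘ[μ] ℝ}
    (hX : X ∈ L1s μ D) : IsWeaklyContinuous μ D X := by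
  let _ := weakTop μ D
  have hXm : Measurable X := X.stronglyMeasurable.measurable
  have hms : ∀ k : ℕ, MeasurableSet {ω | (k : ℝ) < |X ω|} := fun k =>
    measurableSet_lt measurable_const hXm.abs
  have htail : ∀ ε > (0 : ℝ≥0∞), ∀ᶠ k : ℕ in atTop, ∀ Q ∈ D,
      ∫⁻ ω in {ω | (k : ℝ) < |X ω|}, ENNReal.ofReal |X ω| ∂Q < ε := fun ε hε => by
    filter_upwards [(tendsto_order.1 hX).2 ε hε] with k hk Q hQ
    exact (le_iSup₂ (f := fun Q (_ : Q ∈ D) =>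
      ∫⁻ ω in {ω | (k : ℝ) < |X ω|}, ENNReal.ofReal |X ω| ∂Q) Q hQ).trans_lt hk
  have hint : ∀ Q ∈ D, Integrable X Q := fun Q hQ => by
    have := (hD hQ).1
    obtain ⟨k, hk⟩ := (htail 1 one_pos).exists
    refine ⟨hXm.aestronglyMeasurable, ?_⟩
    rw [hasFiniteIntegral_iff_norm]
    simp only [Real.norm_eq_abs]
    rw [← lintegral_add_compl _ (hms k)]
    refine ENNReal.add_lt_top.2 ⟨(hk Q hQ).trans ENNReal.one_lt_top, ?_⟩
    calc _ ≤ ∫⁻ _ in {ω | (k : ℝ) < |X ω|}ᶜ, ENNReal.ofReal k ∂Q :=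
          setLIntegral_mono measurable_const fun ω hω => ENNReal.ofReal_le_ofReal (not_lt.1 hω)
      _ < ∞ := by
        rw [setLIntegral_const]
        exact ENNReal.mul_lt_top ENNReal.ofReal_lt_top (measure_lt_top _ _)
  refine ⟨hint, ?_⟩
  have hunif : TendstoUniformly (fun (k : ℕ) (Q : D) =>
      ∫ ω, ({ω | (k : ℝ) < |X ω|}ᶜ).indicator X ω ∂(Q : Measure Ω))
      (fun Q : D => ∫ ω, X ω ∂(Q : Measure Ω)) atTop := by
    rw [Metric.tendstoUniformly_iff]
    intro ε hε
    filter_upwards [htail (ENNReal.ofReal ε) (ENNReal.ofReal_pos.2 hε)] with k hk Q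
    have hi := hint Q Q.2
    rw [integral_indicator (hms k).compl, ← integral_add_compl (hms k) hi, dist_eq_norm,
      add_sub_cancel_right]
    refine (ENNReal.ofReal_lt_ofReal_iff hε).1 (lt_of_le_of_lt ?_ (hk Q Q.2))
    rw [ofReal_norm]
    refine (enorm_integral_le_lintegral_enorm _).trans (lintegral_mono fun ω => ?_)
    rw [← ofReal_norm, Real.norm_eq_abs]
  refine hunif.continuous (Frequently.of_forall fun k => ?_)
  refine continuous_integral_of_bounded hD (hXm.indicator (hms k).compl) (C := k) fun ω => ?_
  by_cases h : ω ∈ {ω | (k : ℝ) < |X ω|}ᶜ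
  · rw [Set.indicator_of_mem h]
    exact not_lt.1 h
  · rw [Set.indicator_of_notMem h]
    simp

theorem integral_coeFn_add {Q : Measure Ω} (hQ : Q ≪ μ) {X Y : Ω →ₘ[μ] ℝ} (hX : Integrable X Q)
    (hY : Integrable Y Q) : Integrable (X + Y : Ω →ₘ[μ] ℝ) Q ∧
      ∫ ω, (X + Y : Ω →ₘ[μ] ℝ) ω ∂Q = ∫ ω, X ω ∂Q + ∫ ω, Y ω ∂Q := by
  have h : (X + Y : Ω →ₘ[μ] ℝ) =ᵐ[Q] X + Y := hQ.ae_le (AEEqFun.coeFn_add X Y)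
  exact ⟨(hX.add hY).congr h.symm, by rw [← integral_add hX hY]; exact integral_congr_ae h⟩

theorem integral_coeFn_smul {Q : Measure Ω} (hQ : Q ≪ μ) {X : Ω →ₘ[μ] ℝ} (hX : Integrable X Q)
    (c : ℝ) : Integrable (c • X : Ω →ₘ[μ] ℝ) Q ∧
      ∫ ω, (c • X : Ω →ₘ[μ] ℝ) ω ∂Q = c * ∫ ω, X ω ∂Q := by
  have h : (c • X : Ω →ₘ[μ] ℝ) =ᵐ[Q] c • X := hQ.ae_le (AEEqFun.coeFn_smul c X)
  exact ⟨(hX.smul c).congr h.symm, by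
    rw [← integral_const_mul]; exact integral_congr_ae h⟩

theorem integral_coeFn_sum {Q : Measure Ω} (hQ : Q ≪ μ) {ι : Type*} (s : Finset ι)
    {X : ι → (Ω →ₘ[μ] ℝ)} (hX : ∀ i ∈ s, Integrable (X i) Q) (b : ι → ℝ) :
    Integrable (∑ i ∈ s, b i • X i : Ω →ₘ[μ] ℝ) Q ∧
      ∫ ω, (∑ i ∈ s, b i • X i : Ω →ₘ[μ] ℝ) ω ∂Q = ∑ i ∈ s, b i * ∫ ω, X i ω ∂Q := by
  classical
  induction s using Finset.induction_on with
  | empty =>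
    have h : (0 : Ω →ₘ[μ] ℝ) =ᵐ[Q] 0 := hQ.ae_le AEEqFun.coeFn_zero
    simp only [Finset.sum_empty]
    exact ⟨(integrable_zero _ _ _).congr h.symm, by rw [integral_congr_ae h]; simp⟩
  | insert i s hi ih =>
    have h1 := ih fun j hj => hX j (Finset.mem_insert_of_mem hj)
    have h2 := integral_coeFn_smul hQ (hX i (Finset.mem_insert_self _ _)) (b i)
    have h3 := integral_coeFn_add hQ h2.1 h1.1
    rw [Finset.sum_insert hi, Finset.sum_insert hi]
    exact ⟨h3.1, by rw [h3.2, h2.2, h1.2]⟩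

theorem integral_payoff {Q : Measure Ω} (hQ : Q ≪ μ) {d : ℕ} {S : Fin d → (Ω →ₘ[μ] ℝ)}
    (hS : ∀ i, Integrable (S i) Q) (h : EuclideanSpace ℝ (Fin d)) :
    Integrable (payoff h S) Q ∧ ∫ ω, payoff h S ω ∂Q = inner ℝ h (meanVec Q S) := by
  have := integral_coeFn_sum hQ Finset.univ (fun i _ => hS i) h
  refine ⟨this.1, this.2.trans ?_⟩
  simp [meanVec, PiLp.inner_apply, mul_comm]

theorem continuous_meanVec {d : ℕ} {S : Fin d → (Ω →ₘ[μ] ℝ)}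
    (hS : ∀ i, IsWeaklyContinuous μ D (S i)) :
    Continuous[weakTop μ D, _] fun Q : D => meanVec (Q : Measure Ω) S := by
  let _ := weakTop μ D
  have h : ∀ i, Continuous fun Q : D => ∫ ω, S i ω ∂(Q : Measure Ω) := fun i => (hS i).continuous
  unfold meanVec
  fun_prop

theorem IsWeaklyContinuous.add_payoff (hD : D ⊆ acProb μ) {d : ℕ} {S : Fin d → (Ω →ₘ[μ] ℝ)}
    {W : Ω →ₘ[μ] ℝ} (hW : IsWeaklyContinuous μ D W) (hS : ∀ i, IsWeaklyContinuous μ D (S i))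
    (h : EuclideanSpace ℝ (Fin d)) :
    IsWeaklyContinuous μ D (W + payoff h S) ∧ ∀ Q ∈ D,
      ∫ ω, (W + payoff h S) ω ∂Q = inner ℝ h (meanVec Q S) + ∫ ω, W ω ∂Q := by
  let _ := weakTop μ D
  have hp := fun Q (hQ : Q ∈ D) =>
    integral_payoff (hD hQ).2 (fun i => (hS i).integrable Q hQ) h
  have hs := fun Q (hQ : Q ∈ D) =>
    integral_coeFn_add (hD hQ).2 (hW.integrable Q hQ) (hp Q hQ).1
  have he : ∀ Q ∈ D, ∫ ω, (W + payoff h S) ω ∂Q = inner ℝ h (meanVec Q S) + ∫ ω, W ω ∂Q :=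
    fun Q hQ => by rw [(hs Q hQ).2, (hp Q hQ).2, add_comm]
  refine ⟨⟨fun Q hQ => (hs Q hQ).1, ?_⟩, he⟩
  have h1 : (fun Q : D => ∫ ω, (W + payoff h S) ω ∂(Q : Measure Ω)) = fun Q : D =>
      inner ℝ h (meanVec (Q : Measure Ω) S) + ∫ ω, W ω ∂(Q : Measure Ω) := by
    ext Q
    exact he Q Q.2
  rw [h1]
  exact (continuous_const.inner (continuous_meanVec hS)).add hW.continuous

/-- Superhedging duality for `u` on the cone `A`. -/
theorem exists_le_utility_add [SigmaFinite μ] {u : (Ω →ₘ[μ] ℝ) → EReal} (hu : IsCoherentUtility u)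
    (hDc : IsWeaklyCompact μ (determiningSet u)) {A : PointedCone ℝ (Ω →ₘ[μ] ℝ)}
    (hA : IsConsistent (determiningSet u) (A : Set (Ω →ₘ[μ] ℝ)))
    (hne : (determiningSet u ∩ riskNeutral (A : Set (Ω →ₘ[μ] ℝ))).Nonempty)
    {Y : Ω →ₘ[μ] ℝ} (hY : IsWeaklyContinuous μ (determiningSet u) Y) {m : ℝ}
    (hm : ∀ Q ∈ determiningSet u ∩ riskNeutral (A : Set (Ω →ₘ[μ] ℝ)), m < ∫ ω, Y ω ∂Q) :
    ∃ ξ ∈ A, (m : EReal) ≤ u (Y + ξ) := by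
  have hD : determiningSet u ⊆ acProb μ := fun Q hQ => hQ.1
  let _ := weakTop μ (determiningSet u)
  have := compactSpace_weakTop hD hDc
  obtain ⟨A', hA', hDA⟩ := hA
  have hcont : ∀ ξ : A', IsWeaklyContinuous μ (determiningSet u) (ξ : Ω →ₘ[μ] ℝ) := fun ξ =>
    isWeaklyContinuous_of_mem_L1s hD (hA' ξ.2).2
  have hmem : ∀ Q : determiningSet u, (∀ ξ : A', ∫ ω, (ξ : Ω →ₘ[μ] ℝ) ω ∂(Q : Measure Ω) ≤ 0) ↔
      (Q : Measure Ω) ∈ determiningSet u ∩ riskNeutral (A : Set (Ω →ₘ[μ] ℝ)) := fun Q => by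
    rw [hDA]
    have : ∀ ξ : A', expect (Q : Measure Ω) (ξ : Ω →ₘ[μ] ℝ) ≤ 0 ↔
        ∫ ω, (ξ : Ω →ₘ[μ] ℝ) ω ∂(Q : Measure Ω) ≤ 0 := fun ξ => by
      rw [expect_eq_integral ((hcont ξ).integrable Q Q.2)]
      exact EReal.coe_nonpos
    exact ⟨fun h => ⟨Q.2, hD Q.2, fun ξ hξ => (this ⟨ξ, hξ⟩).2 (h ⟨ξ, hξ⟩)⟩,
      fun h ξ => (this ξ).1 (h.2.2 ξ ξ.2)⟩
  -- The constraints are indexed by `A'`, whose expectations are continuous; by consistency they cut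
  -- out the same measures as `A`. The multipliers become the weights of the hedge.
  obtain ⟨s, b, hb, hs⟩ := exists_finset_sum_gt
    (φ := fun (ξ : A') (Q : determiningSet u) => ∫ ω, (ξ : Ω →ₘ[μ] ℝ) ω ∂(Q : Measure Ω))
    (ψ := fun Q : determiningSet u => ∫ ω, Y ω ∂(Q : Measure Ω))
    (fun ξ => (hcont ξ).continuous) hY.continuous
    (fun Q Q' a b ha hb hab => by
      refine ⟨⟨ENNReal.ofReal a • (Q : Measure Ω) + ENNReal.ofReal b • (Q' : Measure Ω),
        mix_mem_determiningSet Q.2 Q'.2 ?_⟩, fun ξ => ?_, ?_⟩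
      · rw [← ENNReal.ofReal_add ha hb, hab, ENNReal.ofReal_one]
      · exact integral_mix ((hcont ξ).integrable Q Q.2) ((hcont ξ).integrable Q' Q'.2) ha hb
      · exact integral_mix (hY.integrable Q Q.2) (hY.integrable Q' Q'.2) ha hb)
    (m := m) (fun Q hQ => hm Q ((hmem Q).1 hQ))
    (by
      obtain ⟨Q, hQ⟩ := hne
      exact ⟨⟨Q, hQ.1⟩, (hmem ⟨Q, hQ.1⟩).2 hQ⟩)
  refine ⟨∑ i, b i • ((i : A') : Ω →ₘ[μ] ℝ), ?_, le_utility hu fun Q hQ => ?_⟩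
  · exact A.sum_mem fun i _ => A.smul_mem (hb i) (hA' i.1.2).1
  · have h1 := integral_coeFn_sum (hD hQ).2 Finset.univ (X := fun i : s => ((i : A') : Ω →ₘ[μ] ℝ))
      (fun i _ => (hcont i).integrable Q hQ) b
    have h2 := integral_coeFn_add (hD hQ).2 (hY.integrable Q hQ) h1.1
    rw [expect_eq_integral h2.1, h2.2, h1.2, EReal.coe_le_coe_iff]
    exact (hs ⟨Q, hQ⟩).le

end WeakTopology

/-! ### Lower boundary and support vectors -/

section LowerBoundary

variable {d : ℕ} {K : Set (EuclideanSpace ℝ (Fin d) × ℝ)}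

theorem isCompact_section (hK : IsCompact K) (x : EuclideanSpace ℝ (Fin d)) :
    IsCompact {y | (x, y) ∈ K} := by
  have h : {y | (x, y) ∈ K} = Prod.snd '' (K ∩ Prod.fst ⁻¹' {x}) := by
    ext y
    constructor
    · exact fun hy => ⟨(x, y), ⟨hy, rfl⟩, rfl⟩
    · rintro ⟨⟨x', y'⟩, ⟨h1, rfl⟩, rfl⟩
      exact h1
  rw [h]
  exact (hK.inter_right (isClosed_singleton.preimage continuous_fst)).image continuous_snd

/-- Sections are compact, so the infimum is attained; `hx` rules out the default value `sInf ∅ = 0`.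
-/
theorem lowerBdry_mem (hK : IsCompact K) {x : EuclideanSpace ℝ (Fin d)} (hx : x ∈ Prod.fst '' K) :
    (x, lowerBdry K x) ∈ K := by
  obtain ⟨⟨x, y⟩, hz, rfl⟩ := hx
  exact (isCompact_section hK x).sInf_mem ⟨y, hz⟩

theorem lowerBdry_le (hK : IsCompact K) {x : EuclideanSpace ℝ (Fin d)} {y : ℝ}
    (h : (x, y) ∈ K) : lowerBdry K x ≤ y :=
  csInf_le (isCompact_section hK x).bddBelow h

theorem mem_normalSet_iff {P η : EuclideanSpace ℝ (Fin d)} (hP : (P, lowerBdry K P) ∈ K) :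
    η ∈ normalSet K P ↔ ∀ z ∈ K, inner ℝ η P + lowerBdry K P ≤ inner ℝ η z.1 + z.2 := by
  constructor
  · exact fun h z hz => h.1 ⟨z, hz, rfl⟩
  · refine fun h => ⟨?_, fun c hc => hc ⟨_, hP, rfl⟩⟩
    rintro _ ⟨z, hz, rfl⟩
    exact h z hz

end LowerBoundary

/-! ### The problem of a single agent -/

section Agent

variable {Ω : Type*} [MeasurableSpace Ω] {μ : Measure Ω} {d : ℕ}
  {u : (Ω →ₘ[μ] ℝ) → EReal} {W : Ω →ₘ[μ] ℝ} {S : Fin d → (Ω →ₘ[μ] ℝ)}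

theorem isCompact_genSetExt (hDc : IsWeaklyCompact μ (determiningSet u)) (A : Set (Ω →ₘ[μ] ℝ))
    (hW : IsWeaklyContinuous μ (determiningSet u) W)
    (hS : ∀ i, IsWeaklyContinuous μ (determiningSet u) (S i)) :
    IsCompact (genSetExt (determiningSet u) A S W) := by
  let _ := weakTop μ (determiningSet u)
  have := compactSpace_weakTop (fun Q hQ => hQ.1) hDc
  have hc : IsCompact (Set.range fun Q : determiningSet u =>
      (meanVec (Q : Measure Ω) S, ∫ ω, W ω ∂(Q : Measure Ω))) :=
    isCompact_range ((continuous_meanVec hS).prodMk hW.continuous)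
  refine hc.of_isClosed_subset isClosed_closure (closure_minimal ?_ hc.isClosed)
  rintro _ ⟨Q, hQ, rfl⟩
  exact ⟨⟨Q, hQ.1⟩, rfl⟩

theorem convex_genSetExt (A : Set (Ω →ₘ[μ] ℝ))
    (hW : IsWeaklyContinuous μ (determiningSet u) W)
    (hS : ∀ i, IsWeaklyContinuous μ (determiningSet u) (S i)) :
    Convex ℝ (genSetExt (determiningSet u) A S W) := by
  refine Convex.closure ?_
  rintro _ ⟨Q, hQ, rfl⟩ _ ⟨Q', hQ', rfl⟩ a b ha hb hab
  have hab' : ENNReal.ofReal a + ENNReal.ofReal b = 1 := by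
    rw [← ENNReal.ofReal_add ha hb, hab, ENNReal.ofReal_one]
  refine ⟨_, ⟨mix_mem_determiningSet hQ.1 hQ'.1 hab', mix_mem_riskNeutral hQ.2 hQ'.2 hab'⟩, ?_⟩
  ext i
  · simp [meanVec, integral_mix ((hS i).integrable Q hQ.1) ((hS i).integrable Q' hQ'.1) ha hb]
  · simp [integral_mix (hW.integrable Q hQ.1) (hW.integrable Q' hQ'.1) ha hb]

/-- Projection commutes with closure because the closure upstairs is compact. -/
theorem genSet_eq_image (hDc : IsWeaklyCompact μ (determiningSet u)) (A : Set (Ω →ₘ[μ] ℝ))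
    (hW : IsWeaklyContinuous μ (determiningSet u) W)
    (hS : ∀ i, IsWeaklyContinuous μ (determiningSet u) (S i)) :
    genSet (determiningSet u) A S = Prod.fst '' genSetExt (determiningSet u) A S W := by
  unfold genSetExt
  rw [image_closure_of_isCompact (isCompact_genSetExt hDc A hW hS) continuous_fst.continuousOn]
  unfold genSet
  congr 1
  ext x
  constructor
  · rintro ⟨Q, hQ, rfl⟩
    exact ⟨_, ⟨Q, hQ, rfl⟩, rfl⟩
  · rintro ⟨_, ⟨Q, hQ, rfl⟩, rfl⟩
    exact ⟨Q, hQ, rfl⟩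

/-- Weak duality: risk-neutrality discards `ξ`, and the bound passes to the closure. -/
theorem utility_le_of_mem_genSetExt {A : Set (Ω →ₘ[μ] ℝ)}
    (hW : IsWeaklyContinuous μ (determiningSet u) W)
    (hS : ∀ i, IsWeaklyContinuous μ (determiningSet u) (S i))
    {ξ : Ω →ₘ[μ] ℝ} (hξ : ξ ∈ A) (η : EuclideanSpace ℝ (Fin d))
    {z : EuclideanSpace ℝ (Fin d) × ℝ} (hz : z ∈ genSetExt (determiningSet u) A S W) :
    u (W + ξ + payoff η S) ≤ ((inner ℝ η z.1 + z.2 : ℝ) : EReal) := by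
  have hcl : IsClosed {z : EuclideanSpace ℝ (Fin d) × ℝ |
      u (W + ξ + payoff η S) ≤ ((inner ℝ η z.1 + z.2 : ℝ) : EReal)} :=
    isClosed_le continuous_const (continuous_coe_real_ereal.comp (by fun_prop))
  refine closure_minimal ?_ hcl hz
  rintro _ ⟨Q, hQ, rfl⟩
  obtain ⟨hi, he⟩ := hW.add_payoff (fun Q hQ => hQ.1) hS η
  have h1 : W + ξ + payoff η S = ξ + (W + payoff η S) := by abel
  refine (hQ.1.2 _).trans ?_
  rw [h1, expect_add hQ.1.1.2 (hi.integrable Q hQ.1), he Q hQ.1]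
  exact (add_le_add (hQ.2.2 ξ hξ) le_rfl).trans_eq (zero_add _)

/-- Strong duality, for levels strictly below the minimum; attainment is not claimed. -/
theorem exists_le_utility_of_lt [SigmaFinite μ] (hu : IsCoherentUtility u)
    (hDc : IsWeaklyCompact μ (determiningSet u)) {A : PointedCone ℝ (Ω →ₘ[μ] ℝ)}
    (hA : IsConsistent (determiningSet u) (A : Set (Ω →ₘ[μ] ℝ)))
    (hW : IsWeaklyContinuous μ (determiningSet u) W)
    (hS : ∀ i, IsWeaklyContinuous μ (determiningSet u) (S i))
    (hne : (genSetExt (determiningSet u) (A : Set (Ω →ₘ[μ] ℝ)) S W).Nonempty)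
    (η : EuclideanSpace ℝ (Fin d)) {m : ℝ}
    (hm : ∀ z ∈ genSetExt (determiningSet u) (A : Set (Ω →ₘ[μ] ℝ)) S W, m < inner ℝ η z.1 + z.2) :
    ∃ ξ ∈ A, (m : EReal) ≤ u (W + ξ + payoff η S) := by
  obtain ⟨hi, he⟩ := hW.add_payoff (fun Q hQ => hQ.1) hS η
  obtain ⟨_, Q, hQ, -⟩ := closure_nonempty_iff.1 hne
  obtain ⟨ξ, hξ, h⟩ := exists_le_utility_add hu hDc hA ⟨Q, hQ⟩ hi (m := m) fun Q hQ => by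
    rw [he Q hQ.1]
    exact hm _ (subset_closure ⟨Q, hQ, rfl⟩)
  refine ⟨ξ, hξ, h.trans_eq ?_⟩
  congr 1
  abel

theorem utility_payoff_excess (hu : IsCoherentUtility u) (Y : Ω →ₘ[μ] ℝ)
    (η P : EuclideanSpace ℝ (Fin d)) :
    u (Y + payoff η (excess S P)) = u (Y + payoff η S) + ((-inner ℝ η P : ℝ) : EReal) := by
  rw [payoff_excess, ← add_assoc, utility_add_const hu]

/-- A support vector at `P` together with an optimal attainable payoff solves the agent's problem
at the price vector `P`. -/
theorem utility_le_of_mem_normalSet [SigmaFinite μ] (hu : IsCoherentUtility u)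
    (hDc : IsWeaklyCompact μ (determiningSet u)) {A : PointedCone ℝ (Ω →ₘ[μ] ℝ)}
    (hA : IsConsistent (determiningSet u) (A : Set (Ω →ₘ[μ] ℝ)))
    (hW : IsWeaklyContinuous μ (determiningSet u) W)
    (hS : ∀ i, IsWeaklyContinuous μ (determiningSet u) (S i))
    {P h : EuclideanSpace ℝ (Fin d)} {X : Ω →ₘ[μ] ℝ}
    (hP : P ∈ genSet (determiningSet u) (A : Set (Ω →ₘ[μ] ℝ)) S)
    (hh : h ∈ normalSet (genSetExt (determiningSet u) (A : Set (Ω →ₘ[μ] ℝ)) S W) P)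
    (hX : X ∈ argmaxOn (fun ξ => u (W + ξ + payoff h S)) (A : Set (Ω →ₘ[μ] ℝ)))
    {ξ : Ω →ₘ[μ] ℝ} (hξ : ξ ∈ A) (η : EuclideanSpace ℝ (Fin d)) :
    u (W + ξ + payoff η (excess S P)) ≤ u (W + X + payoff h (excess S P)) := by
  have hK := isCompact_genSetExt hDc (A : Set (Ω →ₘ[μ] ℝ)) hW hS
  rw [genSet_eq_image hDc _ hW hS] at hP
  have hmem := lowerBdry_mem hK hP
  rw [mem_normalSet_iff hmem] at hh
  rw [utility_payoff_excess hu, utility_payoff_excess hu]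
  set K := genSetExt (determiningSet u) (A : Set (Ω →ₘ[μ] ℝ)) S W
  have h1 : u (W + ξ + payoff η S) ≤ ((inner ℝ η P + lowerBdry K P : ℝ) : EReal) :=
    utility_le_of_mem_genSetExt hW hS hξ η hmem
  have h2 : ((inner ℝ h P + lowerBdry K P : ℝ) : EReal) ≤ u (W + X + payoff h S) := by
    refine EReal.ge_of_forall_gt_iff_ge.1 fun m hm => ?_
    obtain ⟨ξ', hξ', h3⟩ := exists_le_utility_of_lt hu hDc hA hW hS ⟨_, hmem⟩ h (m := m)
      fun z hz => (EReal.coe_lt_coe_iff.1 hm).trans_le (hh z hz)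
    exact h3.trans (hX.2 ξ' hξ')
  calc _ ≤ ((inner ℝ η P + lowerBdry K P : ℝ) : EReal) + ((-inner ℝ η P : ℝ) : EReal) := by gcongr
    _ = ((inner ℝ h P + lowerBdry K P : ℝ) : EReal) + ((-inner ℝ h P : ℝ) : EReal) := by
      rw [← EReal.coe_add, ← EReal.coe_add]
      congr 1
      ring
    _ ≤ _ := by gcongr

/-- If the agent's problem at the price vector `P` is solved by `(X, h)`, then `P` belongs to the
generating set and `h` is a support vector at `P`. -/
theorem mem_of_utility_optimal [SigmaFinite μ] (hu : IsCoherentUtility u)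
    (hDc : IsWeaklyCompact μ (determiningSet u)) {A : PointedCone ℝ (Ω →ₘ[μ] ℝ)}
    (hA : IsConsistent (determiningSet u) (A : Set (Ω →ₘ[μ] ℝ)))
    (hW : IsWeaklyContinuous μ (determiningSet u) W)
    (hS : ∀ i, IsWeaklyContinuous μ (determiningSet u) (S i))
    (hne : (genSetExt (determiningSet u) (A : Set (Ω →ₘ[μ] ℝ)) S W).Nonempty)
    {P h : EuclideanSpace ℝ (Fin d)} {X : Ω →ₘ[μ] ℝ} (hX : X ∈ A)
    (hopt : ∀ ξ ∈ A, ∀ η : EuclideanSpace ℝ (Fin d),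
      u (W + ξ + payoff η (excess S P)) ≤ u (W + X + payoff h (excess S P))) :
    P ∈ genSet (determiningSet u) (A : Set (Ω →ₘ[μ] ℝ)) S ∧
      h ∈ normalSet (genSetExt (determiningSet u) (A : Set (Ω →ₘ[μ] ℝ)) S W) P := by
  have hK := isCompact_genSetExt hDc (A : Set (Ω →ₘ[μ] ℝ)) hW hS
  have hKc := convex_genSetExt (A : Set (Ω →ₘ[μ] ℝ)) hW hS
  rw [genSet_eq_image hDc _ hW hS]
  set K := genSetExt (determiningSet u) (A : Set (Ω →ₘ[μ] ℝ)) S W with hKdef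
  have hmin : ∀ η : EuclideanSpace ℝ (Fin d), ∃ z ∈ K, ∀ z' ∈ K,
      inner ℝ η z.1 + z.2 ≤ inner ℝ η z'.1 + z'.2 := fun η =>
    hK.exists_isMinOn (f := fun z => inner ℝ η z.1 + z.2) hne (Continuous.continuousOn (by fun_prop))
  obtain ⟨z₀, hz₀, hz₀min⟩ := hmin h
  have hupper : u (W + X + payoff h S) ≤ ((inner ℝ h z₀.1 + z₀.2 : ℝ) : EReal) :=
    utility_le_of_mem_genSetExt hW hS hX h hz₀
  -- The height `c` bounds the optimal value from above. If the minimum for some `η` exceeded it,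
  -- strong duality would give a better trade. A point of `K` at or below `(P, c)` gives both
  -- conclusions.
  obtain ⟨y, hy, hPy⟩ := exists_mem_le_of_forall_exists hK hKc (P := P)
    (c := inner ℝ h z₀.1 + z₀.2 - inner ℝ h P) (fun η => by
      obtain ⟨z, hz, hzmin⟩ := hmin η
      refine ⟨z, hz, ?_⟩
      by_contra! hlt
      obtain ⟨m, hm1, hm2⟩ := exists_between hlt
      obtain ⟨ξ, hξ, h3⟩ := exists_le_utility_of_lt hu hDc hA hW hS hne η (m := m)
        fun z' hz' => hm2.trans_le (hzmin z' hz')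
      have h4 := hopt ξ hξ η
      rw [utility_payoff_excess hu, utility_payoff_excess hu] at h4
      have h5 : (m : EReal) + ((-inner ℝ η P : ℝ) : EReal)
          ≤ ((inner ℝ h z₀.1 + z₀.2 : ℝ) : EReal) + ((-inner ℝ h P : ℝ) : EReal) := by
        calc _ ≤ u (W + ξ + payoff η S) + ((-inner ℝ η P : ℝ) : EReal) := by gcongr
          _ ≤ _ := h4
          _ ≤ _ := by gcongr
      rw [← EReal.coe_add, ← EReal.coe_add, EReal.coe_le_coe_iff] at h5
      linarith)
  have hPK : P ∈ Prod.fst '' K := ⟨_, hPy, rfl⟩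
  refine ⟨hPK, (mem_normalSet_iff (lowerBdry_mem hK hPK)).2 fun z hz => ?_⟩
  have := lowerBdry_le hK hPy
  have := hz₀min z hz
  linarith

end Agent

end CoherentEquilibrium

/-! ### Equilibrium: aggregation over agents -/

theorem mainTheorem3 {Ω : Type*} [MeasurableSpace Ω] (μ : Measure Ω) [IsProbabilityMeasure μ]
    {N d : ℕ}
    -- coherent utility functions with weakly compact determining sets `D n`
    (u : Fin N → (Ω →ₘ[μ] ℝ) → EReal) (hu : ∀ n, IsCoherentUtility (u n))
    (D : Fin N → Set (Measure Ω)) (hD : ∀ n, D n = determiningSet (u n))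
    (hDc : ∀ n, IsWeaklyCompact μ (D n))
    -- convex cones of attainable payoffs
    (A : Fin N → PointedCone ℝ (Ω →ₘ[μ] ℝ)) (hA : ∀ n, IsConsistent (D n) (A n : Set (Ω →ₘ[μ] ℝ)))
    -- endowments and contracts
    (W : Fin N → (Ω →ₘ[μ] ℝ)) (hW : ∀ n, W n ∈ L1s μ (D n))
    (S : Fin d → (Ω →ₘ[μ] ℝ)) (hS : ∀ n i, S i ∈ L1s μ (D n))
    -- the sets `G n`, `G̃ n`, `G` and the function `f`
    (Gn : Fin N → Set (EuclideanSpace ℝ (Fin d))) (hGn : ∀ n, Gn n = genSet (D n) (A n) S)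
    (Gt : Fin N → Set (EuclideanSpace ℝ (Fin d) × ℝ))
    (hGt : ∀ n, Gt n = genSetExt (D n) (A n) S (W n))
    (G : Set (EuclideanSpace ℝ (Fin d))) (hG : G = ⋂ n, Gn n)
    (f : EuclideanSpace ℝ (Fin d) → ℝ) (hf : ∀ x, f x = ∑ n, lowerBdry (Gt n) x)
    -- the relative interiors of the `G n` have a common point
    (hri : (⋂ n, intrinsicInterior ℝ (Gn n)).Nonempty) :
    (∀ P ∈ argminOn f G,
      (∃ h : Fin N → EuclideanSpace ℝ (Fin d),
        (∀ n, h n ∈ normalSet (Gt n) P) ∧ ∑ n, h n = 0) ∧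
      ∀ h : Fin N → EuclideanSpace ℝ (Fin d),
        (∀ n, h n ∈ normalSet (Gt n) P) → ∑ n, h n = 0 →
        ∀ X : Fin N → (Ω →ₘ[μ] ℝ),
          (∀ n, X n ∈ argmaxOn (fun ξ => u n (W n + ξ + payoff (h n) S)) (A n)) →
          IsArrowDebreu u (fun n => (A n : Set (Ω →ₘ[μ] ℝ))) W S X h P) ∧
    (∀ (X : Fin N → (Ω →ₘ[μ] ℝ)) (h : Fin N → EuclideanSpace ℝ (Fin d))
        (P : EuclideanSpace ℝ (Fin d)),
      IsArrowDebreu u (fun n => (A n : Set (Ω →ₘ[μ] ℝ))) W S X h P →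
        P ∈ argminOn f G ∧ (∀ n, h n ∈ normalSet (Gt n) P) ∧ ∑ n, h n = 0 ∧
        ∀ n, X n ∈ argmaxOn (fun ξ => u n (W n + ξ + payoff (h n) S)) (A n)) := by
  have hsub : ∀ n, determiningSet (u n) ⊆ acProb μ := fun n Q hQ => hQ.1
  obtain rfl : D = fun n => determiningSet (u n) := funext hD
  obtain rfl : Gn = fun n => genSet (determiningSet (u n)) (A n) S := funext hGn
  obtain rfl : Gt = fun n => genSetExt (determiningSet (u n)) (A n) S (W n) := funext hGt
  obtain rfl : f = fun x => ∑ n, lowerBdry (genSetExt (determiningSet (u n)) (A n) S (W n)) x :=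
    funext hf
  subst hG
  have hW' := fun n => isWeaklyContinuous_of_mem_L1s (hsub n) (hW n)
  have hS' := fun n i => isWeaklyContinuous_of_mem_L1s (hsub n) (hS n i)
  have himg := fun n => genSet_eq_image (hDc n) (A n) (hW' n) (hS' n)
  have hK := fun n => isCompact_genSetExt (hDc n) (A n) (hW' n) (hS' n)
  have hKc := fun n => convex_genSetExt (A n : Set (Ω →ₘ[μ] ℝ)) (hW' n) (hS' n)
  have hmem : ∀ x ∈ ⋂ n, genSet (determiningSet (u n)) (A n : Set (Ω →ₘ[μ] ℝ)) S, ∀ n,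
      (x, lowerBdry (genSetExt (determiningSet (u n)) (A n) S (W n)) x)
        ∈ genSetExt (determiningSet (u n)) (A n : Set (Ω →ₘ[μ] ℝ)) S (W n) := fun x hx n =>
    lowerBdry_mem (hK n) (himg n ▸ Set.mem_iInter.1 hx n)
  obtain ⟨x₀, hx₀⟩ := hri
  rw [Set.mem_iInter] at hx₀
  refine ⟨fun P hP => ⟨?_, fun h hh hsum X hX => ⟨fun n => (hX n).1, hsum, fun n ξ hξ η =>
    utility_le_of_mem_normalSet (hu n) (hDc n) (hA n) (hW' n) (hS' n)
      (Set.mem_iInter.1 hP.1 n) (hh n) (hX n) hξ η⟩⟩, fun X h P heq => ?_⟩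
  · obtain ⟨l, hl0, hl⟩ := exists_multipliers hKc (x₀ := x₀)
      (fun n z hz => by
        have hz1 : z.1 ∈ genSet (determiningSet (u n)) (A n : Set (Ω →ₘ[μ] ℝ)) S :=
          himg n ▸ ⟨z, hz, rfl⟩
        filter_upwards [eventually_add_smul_sub_mem (hx₀ n) hz1] with ε hε
        rw [himg n] at hε
        obtain ⟨⟨_, t⟩, ht, rfl⟩ := hε
        exact ⟨t, ht⟩)
      (hmem P hP.1)
      (fun x y hxy => by
        refine (hP.2 x (Set.mem_iInter.2 fun n => ?_)).trans
          (Finset.sum_le_sum fun n _ => lowerBdry_le (hK n) (hxy n))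
        rw [himg n]
        exact ⟨_, hxy n, rfl⟩)
    let h : Fin N → EuclideanSpace ℝ (Fin d) := fun n =>
      (InnerProductSpace.toDual ℝ _).symm (LinearMap.toContinuousLinearMap (l n))
    have hh : ∀ n x, inner ℝ (h n) x = l n x := fun n x =>
      InnerProductSpace.toDual_symm_apply
    refine ⟨h, fun n => (mem_normalSet_iff (hmem P hP.1 n)).2 fun z hz => ?_, ?_⟩
    · rw [hh, hh]
      exact hl n z hz
    · refine ext_inner_right ℝ fun x => ?_
      simp only [sum_inner, hh, inner_zero_left]
      rw [← LinearMap.sum_apply, hl0, LinearMap.zero_apply]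
  -- In this direction `x₀` serves only to make the generating sets nonempty.
  · have key := fun n => mem_of_utility_optimal (hu n) (hDc n) (hA n) (hW' n) (hS' n)
      (by
        have h1 : x₀ ∈ genSet (determiningSet (u n)) (A n : Set (Ω →ₘ[μ] ℝ)) S :=
          intrinsicInterior_subset (hx₀ n)
        rw [himg n] at h1
        exact Set.Nonempty.of_image ⟨_, h1⟩)
      (heq.mem n) (heq.optimal n)
    have hPG : P ∈ ⋂ n, genSet (determiningSet (u n)) (A n : Set (Ω →ₘ[μ] ℝ)) S :=
      Set.mem_iInter.2 fun n => (key n).1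
    refine ⟨⟨hPG, fun x hx => ?_⟩, fun n => (key n).2, heq.sum_eq_zero, fun n =>
      ⟨heq.mem n, fun ξ hξ => ?_⟩⟩
    -- Each support inequality is tested at the lower boundary point over `x`; clearing cancels the
    -- inner products in the sum.
    · have h1 := Finset.sum_le_sum fun n (_ : n ∈ Finset.univ) =>
        (mem_normalSet_iff (hmem P hPG n)).1 (key n).2 _ (hmem x hx n)
      simp only [Finset.sum_add_distrib, ← sum_inner, heq.sum_eq_zero, inner_zero_left,
        zero_add] at h1
      exact h1
    -- With the portfolio fixed at `h n`, its cost is the same finite constant on both sides.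
    · have h1 := heq.optimal n ξ hξ (h n)
      rw [utility_payoff_excess (hu n), utility_payoff_excess (hu n)] at h1
      have h2 : ∀ x : EReal, x + ((-inner ℝ (h n) P : ℝ) : EReal)
          + ((inner ℝ (h n) P : ℝ) : EReal) = x := fun x => by
        rw [add_assoc, ← EReal.coe_add, neg_add_cancel, EReal.coe_zero, add_zero]
      have h3 := add_le_add_left h1 ((inner ℝ (h n) P : ℝ) : EReal)
      rwa [h2, h2] at h3
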